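/- **Conventions.** Fix a finite set $\mathcal A$ of uninterpreted action symbols, a finite set $\mathcal C$ of channels and a finite set $\mathcal D$ of data symbols containing three distinct symbols $1$, $[\![$ and $]\!]$. Let $\mathcal D_\Box=\mathcal D\cup\{\Box\}$, where $\Box\notin\mathcal D$ is the blank. The set of actions $\mathrm{Act}$ consists of the elements of $\mathcal A$ and the actions $c!d$ (send) and $c?d$ (receive) for $c\in\mathcal C$, $d\in\mathcal D_\Box$; let $\mathrm{Act}_\tau=\mathrm{Act}\cup\{\tau\}$ with $\tau\notin\mathrm{Act}$ unobservable. Fix a dedicated channel $u\in\mathcal C$. A *transition system* is a set of states with a relation $\to\ \subseteq S\times\mathrm{Act}_\tau\times S$, an initial state and a set of final states. Transition systems $T_1,T_2$ are *branching bisimilar*, $T_1\leftrightarroweq_b T_2$, if there is a relation $R\subseteq S_1\times S_2$ relating the initial states such that $s_1\,R\,s_2$ implies: if $s_1\xrightarrow{a}s_1'$ then there are $s_2'',s_2'$ with $s_2\,(\xrightarrow{\tau})^*\,s_2''$, either $s_2''\xrightarrow{a}s_2'$ or ($a=\tau$ and $s_2''=s_2'$), $s_1\,R\,s_2''$ and $s_1'\,R\,s_2'$;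 if $s_1$ is final then there is a final $s_2'$ with $s_2\,(\xrightarrow{\tau})^*\,s_2'$ and $s_1\,R\,s_2'$; and both conditions hold with the two sides exchanged. (No condition on divergence is imposed.) The *parallel composition* $[T_1\parallel T_2]_{\{u\}}$ has state set $S_1\times S_2$; its transitions are the transitions of either component (the other staying put) with a label other than $u!d$, $u?d$, together with a $\tau$-transition whenever one component does $u!d$ and simultaneously the other does $u?d$ for some $d\in\mathcal D_\Box$; its initial state is the pair of initial states, and a pair is final iff both components are. A *reactive Turing machine* (RTM) consists of a finite set $S$ of states, a transition relation $\subseteq S\times\mathcal D_\Box\times\mathrm{Act}_\tau\times\mathcal D_\Box\times\{L,R\}\times S$, an initial state and a set of final states. Its transition system $\mathcal T(M)$ has as states the pairs of a state of $M$ and a two-way infinite tape over $\mathcal D_\Box$, all but finitely many cells of which are blank, with a head position (up to translation). Each transition $(s,d,a,e,m,t)$ of $M$ gives an $a$-labelled transition from every configuration with state $s$ and scanned symbol $d$ to the configuration with state $t$ obtained by writing $e$ over $d$ and moving the head one cell in direction $m$. The initial configuration consists of the initial state and the blank tape, and a configuration is final iff its state is. Fix numberings (injections into $\mathbb N$) of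 $\mathcal A$, $\mathcal C$ and $\mathcal D$. A *Gödel number* of an RTM $M$ with $n$ states is obtained by numbering its states bijectively by $0,\dots,n-1$ and coding, by means of the standard recursive coding of tuples and lists, the number $n$, the number of the initial state, the list of the numbers of the final states, and the list of the codes of the transitions. For $k\in\mathbb N$, let $\overline{k}$ be the RTM with a linear chain of states that sends along $u$ the symbol $[\![$, then $k+1$ symbols $1$, then $]\!]$, and thereupon halts in its unique final state. **Statement.** There exists an RTM $U$ such that, for every RTM $M$ none of whose transitions is labelled with an action $u!d$ or $u?d$, and for every Gödel number $k$ of $M$, $$\mathcal T(M)\ \leftrightarroweq_b\ [\mathcal T(\overline{k})\parallel \mathcal T(U)]_{\{u\}} .$$ -/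

import Mathlib

universe uA uC uD v v₁ v₂

/-- Observable actions. `A` is the set of uninterpreted action symbols, `C` the set of channels and
`D` the set of data symbols. Tape symbols are the elements of `Option D`, with `none` the blank
symbol; `send c d` and `recv c d` are the actions of sending and receiving the tape symbol `d`
along channel `c`. -/
inductive CommAction (A : Type uA) (C : Type uC) (D : Type uD) where
  | obs (a : A) : CommAction A C D
  | send (c : C) (d : Option D) : CommAction A C D
  | recv (c : C) (d : Option D) : CommAction A C D

/-- Actions together with the unobservable event `τ`, which is represented by `none`. -/
abbrev CommActionTau (A : Type uA) (C : Type uC) (D : Type uD) := Option (CommAction A C D)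

/-- Actions as elements of a disjoint union. -/
def CommAction.equivSum (A : Type uA) (C : Type uC) (D : Type uD) :
    CommAction A C D ≃ A ⊕ ((C × Option D) ⊕ (C × Option D)) where
  toFun
    | .obs a => .inl a
    | .send c d => .inr (.inl (c, d))
    | .recv c d => .inr (.inr (c, d))
  invFun
    | .inl a => .obs a
    | .inr (.inl (c, d)) => .send c d
    | .inr (.inr (c, d)) => .recv c d
  left_inv := by rintro (_ | _ | _) <;> rfl
  right_inv := by rintro (_ | ⟨_, _⟩ | ⟨_, _⟩) <;> rfl

instance CommAction.instFinite (A : Type uA) (C : Type uC) (D : Type uD)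
    [Finite A] [Finite C] [Finite D] : Finite (CommAction A C D) :=
  Finite.of_equiv _ (CommAction.equivSum A C D).symm

instance CommAction.instEncodable (A : Type uA) (C : Type uC) (D : Type uD)
    [Encodable A] [Encodable C] [Encodable D] : Encodable (CommAction A C D) :=
  Encodable.ofEquiv _ (CommAction.equivSum A C D)

/-- Head movements as Booleans. -/
def dirEquivBool : Turing.Dir ≃ Bool where
  toFun
    | .left => false
    | .right => true
  invFun
    | false => .left
    | true => .right
  left_inv := by rintro (_ | _) <;> rfl
  right_inv := by rintro (_ | _) <;> rfl

/-- An `CommActionTau A C D`-labelled transition system. -/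
structure TransitionSystem (A : Type uA) (C : Type uC) (D : Type uD) where
  State : Type v
  step : State → CommActionTau A C D → State → Prop
  init : State
  final : Set State

namespace TransitionSystem

variable {A : Type uA} {C : Type uC} {D : Type uD}

/-- `s` reaches `t` by zero or more `τ`-steps. -/
def TauSteps (T : TransitionSystem A C D) : T.State → T.State → Prop :=
  Relation.ReflTransGen (fun s t => T.step s none t)

/-- Either an `a`-step from `s` to `t`, or `a = τ` and `s = t`. -/
def OptStep (T : TransitionSystem A C D) (s : T.State) (a : CommActionTau A C D)
    (t : T.State) : Prop :=
  T.step s a t ∨ (a = none ∧ s = t)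

/-- `R` is a branching bisimulation from `T₁` to `T₂` (no condition on divergence). -/
structure IsBranchingBisimulation (T₁ : TransitionSystem.{uA, uC, uD, v₁} A C D)
    (T₂ : TransitionSystem.{uA, uC, uD, v₂} A C D)
    (R : T₁.State → T₂.State → Prop) : Prop where
  step_left : ∀ s₁ s₂, R s₁ s₂ → ∀ a s₁', T₁.step s₁ a s₁' →
    ∃ s₂'' s₂', T₂.TauSteps s₂ s₂'' ∧ T₂.OptStep s₂'' a s₂' ∧ R s₁ s₂'' ∧ R s₁' s₂'
  step_right : ∀ s₁ s₂, R s₁ s₂ → ∀ a s₂', T₂.step s₂ a s₂' →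
    ∃ s₁'' s₁', T₁.TauSteps s₁ s₁'' ∧ T₁.OptStep s₁'' a s₁' ∧ R s₁'' s₂ ∧ R s₁' s₂'
  final_left : ∀ s₁ s₂, R s₁ s₂ → s₁ ∈ T₁.final →
    ∃ s₂', T₂.TauSteps s₂ s₂' ∧ R s₁ s₂' ∧ s₂' ∈ T₂.final
  final_right : ∀ s₁ s₂, R s₁ s₂ → s₂ ∈ T₂.final →
    ∃ s₁', T₁.TauSteps s₁ s₁' ∧ R s₁' s₂ ∧ s₁' ∈ T₁.final

/-- Branching bisimilarity (divergence-insensitive). -/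
def BranchingBisimilar (T₁ : TransitionSystem.{uA, uC, uD, v₁} A C D)
    (T₂ : TransitionSystem.{uA, uC, uD, v₂} A C D) : Prop :=
  ∃ R : T₁.State → T₂.State → Prop, IsBranchingBisimulation T₁ T₂ R ∧ R T₁.init T₂.init

/-- The label `a` is a send or receive action along one of the channels in `K`. -/
def CommunicatesOn (K : Set C) (a : CommActionTau A C D) : Prop :=
  ∃ c ∈ K, ∃ d : Option D, a = some (.send c d) ∨ a = some (.recv c d)

/-- The parallel composition `[T₁ ∥ T₂]_K`: interleaving, with send and receive actions along the
channels in `K` only occurring as synchronisations, which become `τ`-steps. -/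
def parallel (K : Set C) (T₁ : TransitionSystem.{uA, uC, uD, v₁} A C D)
    (T₂ : TransitionSystem.{uA, uC, uD, v₂} A C D) :
    TransitionSystem A C D where
  State := T₁.State × T₂.State
  step s a s' :=
    ¬ CommunicatesOn K a ∧
      (((T₁.step s.1 a s'.1 ∧ s.2 = s'.2) ∨ (T₂.step s.2 a s'.2 ∧ s.1 = s'.1)) ∨
        (a = none ∧ ∃ c ∈ K, ∃ d : Option D,
          (T₁.step s.1 (some (.send c d)) s'.1 ∧ T₂.step s.2 (some (.recv c d)) s'.2) ∨
          (T₁.step s.1 (some (.recv c d)) s'.1 ∧ T₂.step s.2 (some (.send c d)) s'.2)))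
  init := (T₁.init, T₂.init)
  final := {s | s.1 ∈ T₁.final ∧ s.2 ∈ T₂.final}

end TransitionSystem

/-- A reactive Turing machine. A transition `(s, d, a, e, m, t)` means: in state `s`, reading the
tape symbol `d`, the machine may execute `a`, replace `d` by `e`, move the head in direction `m` and
end up in state `t`. -/
structure RTM (A : Type uA) (C : Type uC) (D : Type uD) where
  State : Type v
  finite_state : Finite State
  rel : Set (State × Option D × CommActionTau A C D × Option D × Turing.Dir × State)
  init : State
  final : Set State

namespace RTM

variable {A : Type uA} {C : Type uC} {D : Type uD}

/-- The transition system associated with an RTM. A configuration is a state together with a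
two-way infinite tape, all but finitely many cells of which are blank, with a head position;
initially the tape is empty. -/
def lts (M : RTM A C D) : TransitionSystem A C D where
  State := M.State × Turing.Tape (Option D)
  step x a y := ∃ (e : Option D) (m : Turing.Dir),
    (x.1, x.2.head, a, e, m, y.1) ∈ M.rel ∧ y.2 = (x.2.write e).move m
  init := (M.init, Turing.Tape.mk₁ [])
  final := {x | x.1 ∈ M.final}

/-- No transition of `M` is labelled with a send or receive action along channel `u`. -/
def DoesNotUse (M : RTM A C D) (u : C) : Prop :=
  ∀ s d a e m t, (s, d, a, e, m, t) ∈ M.rel → ¬ TransitionSystem.CommunicatesOn {u} a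

/-- The number of a transition, given numbers for the states. -/
def transCode [Encodable A] [Encodable C] [Encodable D] {Q : Type*} {n : ℕ} (ν : Q ≃ Fin n) :
    Q × Option D × CommActionTau A C D × Option D × Turing.Dir × Q → ℕ
  | (s, d, a, e, m, t) =>
    Encodable.encode ((ν s : ℕ), d, a, e, dirEquivBool m, (ν t : ℕ))

section Godel

variable [Finite A] [Finite C] [Finite D] [Encodable A] [Encodable C] [Encodable D]

/-- The finite set of the numbers of all transitions of `M`. -/
noncomputable def transCodes (M : RTM A C D) {n : ℕ} (ν : M.State ≃ Fin n) : Finset ℕ :=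
  haveI := M.finite_state
  haveI : Finite Turing.Dir := Finite.of_equiv _ dirEquivBool.symm
  ((Set.toFinite M.rel).image (transCode ν)).toFinset

/-- The finite set of the numbers of all final states of `M`. -/
noncomputable def finalCodes (M : RTM A C D) {n : ℕ} (ν : M.State ≃ Fin n) : Finset ℕ :=
  haveI := M.finite_state
  ((Set.toFinite M.final).image (fun s => (ν s : ℕ))).toFinset

/-- The Gödel number of `M` with respect to the numbering `ν` of its states: the standard code of
the number of states, the number of the initial state, the increasing list of the numbers of the
final states and the increasing list of the numbers of the transitions. -/
noncomputable def godelNumber (M : RTM A C D) {n : ℕ} (ν : M.State ≃ Fin n) : ℕ :=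
  Encodable.encode (n, (ν M.init : ℕ), (M.finalCodes ν).sort (· ≤ ·), (M.transCodes ν).sort (· ≤ ·))

end Godel

/-- The RTM that outputs the symbols of the word `w` one by one along channel `u` and then halts in
its unique final state. -/
def sendWord (A : Type uA) {C : Type uC} {D : Type uD} (u : C) (w : List D) :
    RTM.{uA, uC, uD, 0} A C D where
  State := Fin (w.length + 1)
  finite_state := inferInstance
  rel := {x | ∃ i : Fin w.length,
    x = (i.castSucc, none, some (.send u (some (w.get i))), none, Turing.Dir.right, i.succ)}
  init := 0
  final := {Fin.last w.length}

/-- The RTM that outputs the number `k` along channel `u`, as a sequence of `k + 1` symbols `one`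
delimited by the symbols `lb` and `rb`, and then halts in its unique final state. -/
def sendNumber (A : Type uA) {C : Type uC} {D : Type uD} (u : C) (one lb rb : D) (k : ℕ) :
    RTM.{uA, uC, uD, 0} A C D :=
  sendWord A u ([lb] ++ List.replicate (k + 1) one ++ [rb])

end RTM

-- The simulation goes through an intermediate model, and the two halves are glued by transitivity
-- of branching bisimilarity (`BranchingBisimilar.trans`) and by its compatibility with parallel
-- composition (`BranchingBisimilar.parallel_right`).
--
-- A `NumMachine` has a control state and one natural number; its rules test only the parity of the
-- number and update it by computable functions. A finite `NumMachine` is realised by an RTM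
-- (`exists_branchingBisimilar_rtm`): by `exists_encoding`, compiled recursive codes provide for
-- every computable function a deterministic routine on bit tapes that also outputs the parity of
-- the result. The RTM runs these routines silently between the actions of the rules. By determinism
-- such steps are inert: a configuration stands for the result of the computation it is carrying
-- out.
--
-- The universal `NumMachine` counts the digits it receives, decodes the tables of `M`, and then
-- wanders by `τ`-steps through all pairs of a label and a candidate transition number. The parity
-- of the stored number says whether the current label may be executed. There are finitely many
-- labels, so they fit into the control; everything that depends on `M` is in the number. Nothing is
-- committed before an action is executed, since every other pair remains reachable by `τ`-steps.
-- The search is therefore inert; it diverges, but the equivalence ignores divergence. Termination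
-- is one more label, leading to a final control state that can be left again. The relation `Sim`
-- expresses this argument.

universe v₃

/-! ### Branching bisimilarity: transitivity and compatibility with parallel composition. -/

namespace TransitionSystem

variable {A : Type uA} {C : Type uC} {D : Type uD}
variable {T₁ : TransitionSystem.{uA, uC, uD, v₁} A C D}
  {T₂ : TransitionSystem.{uA, uC, uD, v₂} A C D} {T₃ : TransitionSystem.{uA, uC, uD, v₃} A C D}

/-- Branching bisimulations are closed under taking converses. -/
theorem IsBranchingBisimulation.flip {R : T₁.State → T₂.State → Prop}
    (h : IsBranchingBisimulation T₁ T₂ R) : IsBranchingBisimulation T₂ T₁ (flip R) where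
  step_left s t := h.step_right t s
  step_right s t := h.step_left t s
  final_left s t := h.final_right t s
  final_right s t := h.final_left t s

/-- A sequence of `τ`-steps is matched by a sequence of `τ`-steps. -/
theorem IsBranchingBisimulation.tauSteps {R : T₁.State → T₂.State → Prop}
    (h : IsBranchingBisimulation T₁ T₂ R) {s s' : T₁.State} {t : T₂.State} (hst : R s t)
    (hs : T₁.TauSteps s s') : ∃ t', T₂.TauSteps t t' ∧ R s' t' := by
  induction hs with
  | refl => exact ⟨t, .refl, hst⟩
  | tail _ hstep ih =>
    obtain ⟨t', ht, hr⟩ := ih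
    obtain ⟨u, u', hu, hopt, -, hr'⟩ := h.step_left _ _ hr _ _ hstep
    rcases hopt with hopt | ⟨-, rfl⟩
    · exact ⟨u', (ht.trans hu).tail hopt, hr'⟩
    · exact ⟨u, ht.trans hu, hr'⟩

/-- The composition of two branching bisimulations, at the level of steps of the left system. -/
theorem IsBranchingBisimulation.comp_step {R : T₁.State → T₂.State → Prop}
    {R' : T₂.State → T₃.State → Prop} (h : IsBranchingBisimulation T₁ T₂ R)
    (h' : IsBranchingBisimulation T₂ T₃ R') {s s' : T₁.State} {u : T₃.State}
    (hsu : Relation.Comp R R' s u) {a : CommActionTau A C D} (hs : T₁.step s a s') :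
    ∃ u'' u', T₃.TauSteps u u'' ∧ T₃.OptStep u'' a u' ∧ Relation.Comp R R' s u'' ∧
      Relation.Comp R R' s' u' := by
  obtain ⟨t, hst, htu⟩ := hsu
  obtain ⟨t'', t', htt, hopt, hr, hr'⟩ := h.step_left _ _ hst _ _ hs
  -- Nothing is required of the intermediate states of the `τ`-path to `t''`, so it suffices to
  -- match its end point, which is again related to `s`.
  obtain ⟨u₁, hu₁, hru⟩ := h'.tauSteps htu htt
  rcases hopt with hopt | ⟨rfl, rfl⟩
  · obtain ⟨u'', u', hu'', hopt', hru'', hru'⟩ := h'.step_left _ _ hru _ _ hopt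
    exact ⟨u'', u', hu₁.trans hu'', hopt', ⟨_, hr, hru''⟩, ⟨_, hr', hru'⟩⟩
  · exact ⟨u₁, u₁, hu₁, .inr ⟨rfl, rfl⟩, ⟨_, hr, hru⟩, ⟨_, hr', hru⟩⟩

/-- The composition of two branching bisimulations, at the level of final states of the left
system. -/
theorem IsBranchingBisimulation.comp_final {R : T₁.State → T₂.State → Prop}
    {R' : T₂.State → T₃.State → Prop} (h : IsBranchingBisimulation T₁ T₂ R)
    (h' : IsBranchingBisimulation T₂ T₃ R') {s : T₁.State} {u : T₃.State}
    (hsu : Relation.Comp R R' s u) (hs : s ∈ T₁.final) :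
    ∃ u', T₃.TauSteps u u' ∧ Relation.Comp R R' s u' ∧ u' ∈ T₃.final := by
  obtain ⟨t, hst, htu⟩ := hsu
  obtain ⟨t', htt, hr, hf⟩ := h.final_left _ _ hst hs
  obtain ⟨u₁, hu₁, hru⟩ := h'.tauSteps htu htt
  obtain ⟨u', hu', hru', hf'⟩ := h'.final_left _ _ hru hf
  exact ⟨u', hu₁.trans hu', ⟨_, hr, hru'⟩, hf'⟩

/-- Branching bisimilarity is transitive. -/
theorem BranchingBisimilar.trans (h : BranchingBisimilar T₁ T₂) (h' : BranchingBisimilar T₂ T₃) :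
    BranchingBisimilar T₁ T₃ := by
  obtain ⟨R, hR, hi⟩ := h
  obtain ⟨R', hR', hi'⟩ := h'
  -- The two conditions on steps and final states of the right system are those of the left system
  -- for the converse relations.
  have key : Relation.Comp (_root_.flip R') (_root_.flip R)
      = _root_.flip (Relation.Comp R R') := Relation.flip_comp.symm
  refine ⟨Relation.Comp R R', ⟨fun s u h a s' hs => hR.comp_step hR' h hs, fun s u h a u' hu => ?_,
    fun s u h hs => hR.comp_final hR' h hs, fun s u h hu => ?_⟩, _, hi, hi'⟩
  · have := hR'.flip.comp_step hR.flip (s := u) (u := s) (by rw [key]; exact h) hu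
    rwa [key] at this
  · have := hR'.flip.comp_final hR.flip (s := u) (u := s) (by rw [key]; exact h) hu
    rwa [key] at this

theorem not_communicatesOn_none (K : Set C) :
    ¬ CommunicatesOn K (none : CommActionTau A C D) := by
  rintro ⟨c, -, d, h | h⟩ <;> cases h

/-- A `τ`-step of the right component is a `τ`-step of the parallel composition. -/
theorem parallel_tauSteps_right (K : Set C) (T : TransitionSystem.{uA, uC, uD, v} A C D)
    (p : T.State) {t t' : T₂.State} (h : T₂.TauSteps t t') :
    (parallel K T T₂).TauSteps (p, t) (p, t') :=
  Relation.ReflTransGen.lift (fun t => (p, t))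
    (fun _ _ hs => ⟨not_communicatesOn_none K, .inl (.inr ⟨hs, rfl⟩)⟩) _ _ h

/-- The preparatory `τ`-steps leave `T` in place, so `T` can still perform its half of a
synchronisation; the other half has a visible label and cannot be matched by standing still. -/
theorem IsBranchingBisimulation.parallel_step {R : T₁.State → T₂.State → Prop}
    (h : IsBranchingBisimulation T₁ T₂ R) (K : Set C) (T : TransitionSystem.{uA, uC, uD, v} A C D)
    {p p' : T.State} {s s' : T₁.State} {t : T₂.State} (hst : R s t) {a : CommActionTau A C D}
    (hs : (parallel K T T₁).step (p, s) a (p', s')) :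
    ∃ t'' t', (parallel K T T₂).TauSteps (p, t) (p, t'') ∧
      (parallel K T T₂).OptStep (p, t'') a (p', t') ∧ R s t'' ∧ R s' t' := by
  obtain ⟨hK, (⟨hp, hss⟩ | ⟨hs, hpp⟩) | ⟨ha, c, hc, d, hcd⟩⟩ := hs
  · obtain rfl : s = s' := hss
    exact ⟨t, t, .refl, .inl ⟨hK, .inl (.inl ⟨hp, rfl⟩)⟩, hst, hst⟩
  · obtain rfl : p = p' := hpp
    obtain ⟨t'', t', ht, hopt, hr, hr'⟩ := h.step_left _ _ hst _ _ hs
    refine ⟨t'', t', parallel_tauSteps_right K T p ht, ?_, hr, hr'⟩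
    rcases hopt with hopt | ⟨ha, rfl⟩
    · exact .inl ⟨hK, .inl (.inr ⟨hopt, rfl⟩)⟩
    · exact .inr ⟨ha, rfl⟩
  · rcases hcd with ⟨hp, hs⟩ | ⟨hp, hs⟩
    · obtain ⟨t'', t', ht, hopt, hr, hr'⟩ := h.step_left _ _ hst _ _ hs
      rcases hopt with hopt | ⟨ha', -⟩
      · exact ⟨t'', t', parallel_tauSteps_right K T p ht,
          .inl ⟨hK, .inr ⟨ha, c, hc, d, .inl ⟨hp, hopt⟩⟩⟩, hr, hr'⟩
      · cases ha'
    · obtain ⟨t'', t', ht, hopt, hr, hr'⟩ := h.step_left _ _ hst _ _ hs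
      rcases hopt with hopt | ⟨ha', -⟩
      · exact ⟨t'', t', parallel_tauSteps_right K T p ht,
          .inl ⟨hK, .inr ⟨ha, c, hc, d, .inr ⟨hp, hopt⟩⟩⟩, hr, hr'⟩
      · cases ha'

theorem IsBranchingBisimulation.parallel_final {R : T₁.State → T₂.State → Prop}
    (h : IsBranchingBisimulation T₁ T₂ R) (K : Set C) (T : TransitionSystem.{uA, uC, uD, v} A C D)
    {p : T.State} {s : T₁.State} {t : T₂.State} (hst : R s t)
    (hs : (p, s) ∈ (parallel K T T₁).final) :
    ∃ t', (parallel K T T₂).TauSteps (p, t) (p, t') ∧ R s t' ∧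
      (p, t') ∈ (parallel K T T₂).final := by
  obtain ⟨t', ht, hr, hf⟩ := h.final_left _ _ hst hs.2
  exact ⟨t', parallel_tauSteps_right K T p ht, hr, hs.1, hf⟩

/-- Parallel composition respects branching bisimilarity in its right argument. -/
theorem BranchingBisimilar.parallel_right (h : BranchingBisimilar T₁ T₂) (K : Set C)
    (T : TransitionSystem.{uA, uC, uD, v} A C D) :
    BranchingBisimilar (parallel K T T₁) (parallel K T T₂) := by
  obtain ⟨R, hR, hi⟩ := h
  refine ⟨fun x y => x.1 = y.1 ∧ R x.2 y.2, ⟨?_, ?_, ?_, ?_⟩, rfl, hi⟩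
  · rintro ⟨p, s⟩ ⟨_, t⟩ ⟨rfl, hst⟩ a ⟨p', s'⟩ hs
    obtain ⟨t'', t', h₁, h₂, h₃, h₄⟩ := hR.parallel_step K T hst hs
    exact ⟨(p, t''), (p', t'), h₁, h₂, ⟨rfl, h₃⟩, rfl, h₄⟩
  · rintro ⟨p, s⟩ ⟨_, t⟩ ⟨rfl, hst⟩ a ⟨p', t'⟩ ht
    obtain ⟨s'', s', h₁, h₂, h₃, h₄⟩ := hR.flip.parallel_step K T hst ht
    exact ⟨(p, s''), (p', s'), h₁, h₂, ⟨rfl, h₃⟩, rfl, h₄⟩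
  · rintro ⟨p, s⟩ ⟨_, t⟩ ⟨rfl, hst⟩ hs
    obtain ⟨t', h₁, h₂, h₃⟩ := hR.parallel_final K T hst hs
    exact ⟨(p, t'), h₁, ⟨rfl, h₂⟩, h₃⟩
  · rintro ⟨p, s⟩ ⟨_, t⟩ ⟨rfl, hst⟩ ht
    obtain ⟨s', h₁, h₂, h₃⟩ := hR.flip.parallel_final K T hst ht
    exact ⟨(p, s'), h₁, ⟨rfl, h₂⟩, h₃⟩

end TransitionSystem

/-! ### Deterministic routines on bit tapes. -/

/-- A finite deterministic machine on a two-way infinite tape of bits, with post-machine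
instructions and an output bit attached to every state. -/
structure BitRoutine where
  State : Type
  finite_state : Finite State
  next : State → Bool → Option (State × Turing.TM0.Stmt Bool)
  start : State
  out : State → Bool

namespace BitRoutine

open Turing StateTransition

/-- The effect of an instruction on the tape. -/
def effect : TM0.Stmt Bool → Tape Bool → Tape Bool
  | .move d, T => T.move d
  | .write b, T => T.write b

/-- The step function on configurations. -/
def step (P : BitRoutine) (c : P.State × Tape Bool) : Option (P.State × Tape Bool) :=
  (P.next c.1 c.2.head).map fun r => (r.1, effect r.2 c.2)

/-- Started on the tape `T`, the routine halts with tape `T'` and output `b`. -/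
def Runs (P : BitRoutine) (T T' : Tape Bool) (b : Bool) : Prop :=
  ∃ q, Reaches P.step (P.start, T) (q, T') ∧ P.next q T'.head = none ∧ P.out q = b

/-- Run `P`, then the routine selected by its output. -/
def bind (P : BitRoutine) (K : Bool → BitRoutine) : BitRoutine where
  State := P.State ⊕ Σ b, (K b).State
  finite_state :=
    haveI := P.finite_state
    haveI := fun b => (K b).finite_state
    inferInstance
  next
    -- Where `P` halts, the scanned bit is rewritten unchanged while control passes to the selected
    -- routine.
    | .inl q, c => some <| ((P.next q c).map fun r => (Sum.inl r.1, r.2)).getD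
        (.inr ⟨P.out q, (K (P.out q)).start⟩, .write c)
    | .inr ⟨b, q⟩, c => ((K b).next q c).map fun r => (.inr ⟨b, r.1⟩, r.2)
  start := .inl P.start
  out
    | .inl _ => false
    | .inr ⟨b, q⟩ => (K b).out q

theorem Runs.bind {P : BitRoutine} {K : Bool → BitRoutine} {T T' T'' : Tape Bool} {b c : Bool}
    (h : P.Runs T T' b) (h' : (K b).Runs T' T'' c) : (P.bind K).Runs T T'' c := by
  obtain ⟨q, hq, hn, rfl⟩ := h
  obtain ⟨q', hq', hn', rfl⟩ := h'
  refine ⟨.inr ⟨P.out q, q'⟩, ?_, by simp only [BitRoutine.bind, hn', Option.map_none], rfl⟩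
  have h₁ : Reaches (P.bind K).step (.inl P.start, T) (.inl q, T') := by
    refine Relation.ReflTransGen.lift
      (fun x : P.State × Tape Bool => ((.inl x.1 : (P.bind K).State), x.2)) ?_ _ _ hq
    rintro ⟨p, T⟩ y hy
    obtain ⟨r, hr, rfl⟩ := Option.map_eq_some_iff.1 hy
    simp only at hr
    simp only [Function.onFun, step, BitRoutine.bind, hr]
    rfl
  have h₂ : Reaches (P.bind K).step (.inl q, T') (.inr ⟨P.out q, (K (P.out q)).start⟩, T') :=
    .single (by simp [step, BitRoutine.bind, hn, effect, Tape.write_self]; rfl)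
  refine (h₁.trans h₂).trans (Relation.ReflTransGen.lift
      (fun x : (K (P.out q)).State × Tape Bool =>
        ((.inr ⟨_, x.1⟩ : (P.bind K).State), x.2)) ?_ _ _ hq')
  rintro ⟨p, T⟩ y hy
  obtain ⟨r, hr, rfl⟩ := Option.map_eq_some_iff.1 hy
  simp only at hr
  simp only [Function.onFun, step, BitRoutine.bind, hr]
  rfl

/-- Replace the outputs. -/
def mapOut (P : BitRoutine) (f : Bool → Bool) : BitRoutine :=
  { P with out := fun q => f (P.out q) }

theorem Runs.mapOut {P : BitRoutine} {T T' : Tape Bool} {b : Bool} (h : P.Runs T T' b)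
    (f : Bool → Bool) : (P.mapOut f).Runs T T' (f b) := by
  obtain ⟨q, hq, hn, rfl⟩ := h
  exact ⟨q, hq, hn, rfl⟩

/-- Perform one instruction and output `b`. -/
def single (s : TM0.Stmt Bool) (b : Bool) : BitRoutine where
  State := Bool
  finite_state := inferInstance
  next
    | false, _ => some (true, s)
    | true, _ => none
  start := false
  out _ := b

theorem runs_single (s : TM0.Stmt Bool) (b : Bool) (T : Tape Bool) :
    (single s b).Runs T (effect s T) b :=
  ⟨true, .single rfl, rfl, rfl⟩

/-- Output the scanned bit. -/
def read : BitRoutine where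
  State := Option Bool
  finite_state := inferInstance
  next
    | none, c => some (some c, .write c)
    | some _, _ => none
  start := none
  out q := q.getD false

theorem runs_read (T : Tape Bool) : read.Runs T T T.head :=
  ⟨some T.head, .single (by simp [step, read, effect, Tape.write_self]; rfl), rfl, rfl⟩

/-- Output the bit at distance `p` to the right of the head. -/
def readAt : ℕ → BitRoutine
  | 0 => read
  | p + 1 => (single (.move .right) false).bind fun _ =>
      (readAt p).bind fun b => single (.move .left) b

theorem runs_readAt (p : ℕ) (T : Tape Bool) : (readAt p).Runs T T (T.nth p) := by
  induction p generalizing T with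
  | zero => exact runs_read T
  | succ p ih =>
    refine (runs_single _ _ T).bind ((ih _).bind ?_)
    have h := runs_single (.move .left) (T.nth (p + 1 : ℕ)) (T.move .right)
    rw [effect, Tape.move_right_left] at h
    simpa [effect, Tape.move_right_nth] using h

/-- Write a word to the right of the head and return. -/
def writeWord : List Bool → BitRoutine
  -- `read` serves as a routine that leaves the tape alone; its output is irrelevant here.
  | [] => read
  | b :: w => (single (.write b) false).bind fun _ => (single (.move .right) false).bind fun _ =>
      (writeWord w).bind fun _ => single (.move .left) false

theorem exists_runs_writeWord (w : List Bool) (L : ListBlank Bool) :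
    ∃ b, (writeWord w).Runs (Tape.mk' L (ListBlank.mk [])) (Tape.mk' L (ListBlank.mk w)) b := by
  induction w generalizing L with
  | nil => exact ⟨_, runs_read _⟩
  | cons b w ih =>
    obtain ⟨c, hc⟩ := ih (L.cons b)
    refine ⟨false, (runs_single _ _ _).bind ((runs_single _ _ _).bind
      (.bind (T' := Tape.mk' (L.cons b) (ListBlank.mk w)) (b := c) ?_ ?_))⟩
    · convert hc using 1
      simp [effect, Tape.mk', Tape.write, Tape.move]
    · have h := runs_single (.move .left) false (Tape.mk' (L.cons b) (ListBlank.mk w))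
      rwa [effect, Tape.move_left_mk', ListBlank.head_cons, ListBlank.tail_cons,
        ListBlank.cons_mk] at h

/-- The restriction of a Turing machine to a finite set of states. -/
noncomputable def ofTM0 {Λ : Type} [Inhabited Λ] (M : TM0.Machine Bool Λ) (S : Finset Λ)
    (q₀ : S) : BitRoutine where
  State := S
  finite_state := inferInstance
  next q c := open scoped Classical in
    -- The default `q₀` is never used when `S` supports `M`.
    (M q c).map fun r => (if h : r.1 ∈ S then ⟨r.1, h⟩ else q₀, r.2)
  start := q₀
  out _ := false

theorem runs_ofTM0 {Λ : Type} [Inhabited Λ] {M : TM0.Machine Bool Λ} {S : Finset Λ}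
    (hS : TM0.Supports M (S : Set Λ)) {q₀ : Λ} (h₀ : q₀ ∈ S) {T : Tape Bool} {c : TM0.Cfg Bool Λ}
    (hc : c ∈ eval (TM0.step M) ⟨q₀, T⟩) : (ofTM0 M S ⟨q₀, h₀⟩).Runs T c.Tape false := by
  obtain ⟨hr, hn⟩ := mem_eval.1 hc
  have key : ∃ h : c.q ∈ S, Reaches (ofTM0 M S ⟨q₀, h₀⟩).step (⟨q₀, h₀⟩, T) (⟨c.q, h⟩, c.Tape) := by
    clear hn hc
    induction hr with
    | refl => exact ⟨h₀, .refl⟩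
    | @tail d e _ hde ih =>
      obtain ⟨hd, hreach⟩ := ih
      obtain ⟨q, U⟩ := d
      obtain ⟨⟨q', s⟩, hq', rfl⟩ := Option.map_eq_some_iff.1 hde
      have hmem : q' ∈ S := hS.2 hq' hd
      refine ⟨hmem, hreach.tail ?_⟩
      have hq'' : M q U.head = some (q', s) := hq'
      simp only [step, ofTM0, hq'', Option.map_some, dif_pos hmem]
      cases s <;> rfl
  obtain ⟨h, hreach⟩ := key
  refine ⟨⟨c.q, h⟩, hreach, ?_, rfl⟩
  have : M c.q c.Tape.head = none := by
    simpa [TM0.step] using hn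
  simp [ofTM0, this]

/-! ### Computable functions by routines. -/

/-- The symbols of the tape carrying the stacks of Mathlib's evaluator of codes. -/
abbrev StackSymbol : Type := TM2to1.Γ' PartrecToTM2.K' (fun _ => PartrecToTM2.Γ')

instance fintypeStackIndex : Fintype PartrecToTM2.K' :=
  ⟨{.main, .rev, .aux, .stack}, by rintro ⟨⟩ <;> simp⟩

/-- A column of the tape whose main stack holds `a`. -/
def mainColumn (a : PartrecToTM2.Γ') : PartrecToTM2.K' → Option PartrecToTM2.Γ' :=
  Function.update (fun _ => none) .main (some a)

/-- The columns of the tape for the list of numbers `v`. -/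
def listColumns (v : List ℕ) : ListBlank (PartrecToTM2.K' → Option PartrecToTM2.Γ') :=
  ListBlank.mk ((PartrecToTM2.trList v).reverse.map mainColumn)

/-- The translation from stacks to a tape specifies the tape through its four projections, each
stack being written from the bottom up; only the main stack is nonempty. -/
theorem listColumns_proj (v : List ℕ) (k : PartrecToTM2.K') :
    (listColumns v).map (proj k) = ListBlank.mk
      (((PartrecToTM2.K'.elim (PartrecToTM2.trList v) [] [] [] k).map some).reverse) := by
  refine ListBlank.ext fun i => ?_
  rw [listColumns, ListBlank.map_mk, ListBlank.nth_mk, ListBlank.nth_mk,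
    List.getI_eq_getElem?_getD, List.getI_eq_getElem?_getD, List.map_map, ← List.map_reverse,
    List.getElem?_map, List.getElem?_map]
  cases k
  · rw [PartrecToTM2.K'.elim_main]
    cases (PartrecToTM2.trList v).reverse[i]? <;> rfl
  · rw [PartrecToTM2.K'.elim_rev]
    cases (PartrecToTM2.trList v).reverse[i]? <;> rfl
  · rw [PartrecToTM2.K'.elim_aux]
    cases (PartrecToTM2.trList v).reverse[i]? <;> rfl
  · rw [PartrecToTM2.K'.elim_stack]
    cases (PartrecToTM2.trList v).reverse[i]? <;> rfl

/-- A symbol of the tape, composed of the bottom marker and a column. -/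
def stackSymbol (b : Bool) (c : PartrecToTM2.K' → Option PartrecToTM2.Γ') : StackSymbol :=
  (b, c)

theorem addBottom_mk_cons (a : PartrecToTM2.K' → Option PartrecToTM2.Γ')
    (l : List (PartrecToTM2.K' → Option PartrecToTM2.Γ')) :
    TM2to1.addBottom (ListBlank.mk (a :: l)) =
      ListBlank.mk (Γ := StackSymbol) (stackSymbol true a :: l.map (stackSymbol false)) :=
  rfl

variable {n : ℕ} {enc : StackSymbol → List.Vector Bool n}
  (enc0 : enc default = List.Vector.replicate n false)

/-- The tape of bits for the list of numbers `v`. -/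
def listTape (v : List ℕ) : Tape Bool :=
  TM1to1.trTape enc0 (Tape.mk' ∅ (TM2to1.addBottom (listColumns v)))

/-- The evaluator of codes is translated from stacks to one tape, then to bits, then to post-machine
instructions; its support is finite at every stage. The tape for the result is again in the normal
form of an input, so routines can be chained. -/
theorem exists_runs_code {dec : List.Vector Bool n → StackSymbol}
    (encdec : ∀ a, dec (enc a) = a) (c : ToPartrec.Code) :
    ∃ P : BitRoutine, ∀ v w, w ∈ c.eval v → P.Runs (listTape enc0 v) (listTape enc0 w) false := by
  -- The translations start in the default state, which is therefore chosen to be the entry point of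
  -- `c`.
  let _ : Inhabited PartrecToTM2.Λ' := ⟨PartrecToTM2.trNormal c .halt⟩
  have h2 : TM2.Supports PartrecToTM2.tr (PartrecToTM2.codeSupp c .halt) :=
    PartrecToTM2.tr_supports c .halt
  have h1 := TM2to1.tr_supports _ h2
  have h1' := TM1to1.tr_supports (enc := enc) (dec := dec) _ h1
  have h0 := TM1to0.tr_supports _ h1'
  refine ⟨ofTM0 (TM1to0.tr (TM1to1.tr enc dec (TM2to1.tr PartrecToTM2.tr))) (TM1to0.trStmts _
    (TM1to1.trSupp _ (TM2to1.trSupp _ (PartrecToTM2.codeSupp c .halt)))) ⟨default, h0.1⟩,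
    fun v w hw => ?_⟩
  have hev : PartrecToTM2.halt w ∈ eval (TM2.step PartrecToTM2.tr) (PartrecToTM2.init c v) := by
    rw [PartrecToTM2.tr_eval]
    exact Part.mem_map _ hw
  obtain ⟨b₁, hb₁, hev₁⟩ := tr_eval (TM2to1.tr_respects PartrecToTM2.tr)
    (TM2to1.TrCfg.mk (listColumns v) (listColumns_proj v)) hev
  obtain ⟨b₂, rfl, hev₂⟩ := tr_eval (TM1to1.tr_respects (enc0 := enc0) dec _ encdec) rfl hev₁
  obtain ⟨b₃, rfl, hev₃⟩ := tr_eval (TM1to0.tr_respects _) rfl hev₂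
  have htape : b₁.Tape = Tape.mk' ∅ (TM2to1.addBottom (listColumns w)) := by
    generalize hd : PartrecToTM2.halt w = d at hb₁
    obtain ⟨L, hL⟩ := hb₁
    -- A column is determined by its entries for the four stacks.
    have : L = listColumns w := by
      refine ListBlank.ext fun i => funext fun k => ?_
      rw [← proj_map_nth, ← proj_map_nth, hL, listColumns_proj]
      cases hd
      rfl
    rw [this]
  have key := runs_ofTM0 h0 h0.1 hev₃
  have : (TM1to0.trCfg (TM1to1.tr enc dec (TM2to1.tr PartrecToTM2.tr))
      (TM1to1.trCfg enc enc0 b₁)).Tape = listTape enc0 w := by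
    rw [listTape, ← htape]
    rfl
  rw [this] at key
  exact key

/-- The tape of bits for the number `x`; its last bit is stored separately. -/
def natTape (x : ℕ) : Tape Bool := listTape enc0 [x / 2, x % 2]

/-- The argument is recovered as `2 * a + b`; quotient and remainder of the value are computed by
separate codes. -/
theorem exists_code_pair {f : ℕ → ℕ} (hf : Computable f) :
    ∃ c : ToPartrec.Code, ∀ x, c.eval [x / 2, x % 2] = pure [f x / 2, f x % 2] := by
  have hx : Computable₂ fun a b : ℕ => f (2 * a + b) :=
    hf.comp ((Primrec.nat_add.comp (Primrec.nat_mul.comp (.const 2) .fst) .snd).to_comp)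
  have h : ∀ g : ℕ → ℕ, Primrec g → ∃ c : ToPartrec.Code,
      ∀ a b, c.eval [a, b] = pure [g (f (2 * a + b))] := fun g hg => by
    have hp : Nat.Partrec' (n := 2) fun v => Part.some (g (f (2 * v.head + v.tail.head))) :=
      Nat.Partrec'.part_iff₂ (f := fun a b : ℕ => Part.some (g (f (2 * a + b)))) |>.2
        (hg.to_comp.comp hx)
    obtain ⟨c, hc⟩ := ToPartrec.Code.exists_code hp
    exact ⟨c, fun a b => (hc ⟨[a, b], rfl⟩).trans (Part.map_some _ _)⟩
  obtain ⟨c₁, h₁⟩ := h (· / 2) (Primrec.nat_div.comp .id (.const 2))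
  obtain ⟨c₂, h₂⟩ := h (· % 2) (Primrec.nat_mod.comp .id (.const 2))
  refine ⟨.cons c₁ c₂, fun x => ?_⟩
  simp [h₁, h₂, Nat.div_add_mod]

/-- The stack is written bottom first from the head, so column `0` holds the final separator `cons`.
Column `1` belongs to the number `x % 2`: it is `bit1` for `1`, and for `0`, whose binary expansion
is empty, it is the preceding `cons`. A bit `j` in which the two codes differ thus reveals the
parity at the position `n + j`, independent of `x`. -/
theorem exists_readAt_natTape (hinj : Function.Injective enc) :
    ∃ (p : ℕ) (g : Bool → Bool), ∀ x : ℕ, g ((natTape enc0 x).nth p) = x.bodd := by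
  have hne : enc (stackSymbol false <| mainColumn .cons) ≠
      enc (stackSymbol false <| mainColumn .bit1) := fun h => by
    have := congrFun (congrArg Prod.snd (hinj h)) PartrecToTM2.K'.main
    simp [stackSymbol, mainColumn] at this
  obtain ⟨j, hj⟩ : ∃ j : Fin n, (enc (stackSymbol false <| mainColumn .cons)).get j ≠
      (enc (stackSymbol false <| mainColumn .bit1)).get j := by
    by_contra! h
    exact hne (List.Vector.ext h)
  have key : ∀ (a : ℕ) (s : PartrecToTM2.Γ') (l : List PartrecToTM2.Γ') (b : ℕ),
      (PartrecToTM2.trList [a, b]).reverse = .cons :: s :: l →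
      (listTape enc0 [a, b]).nth ((n + j : ℕ) : ℤ) =
        (enc (stackSymbol false <| mainColumn s)).get j := by
    intro a s l b h
    rw [listTape, TM1to1.trTape_mk', TM1to1.trTape', Tape.mk'_nth_nat, listColumns, h]
    rw [List.map_cons, addBottom_mk_cons, ListBlank.flatMap_mk, ListBlank.nth_mk]
    simp only [List.map_cons, List.flatMap_cons]
    rw [List.getI_append_right _ _ _ (by simp), List.getI_append _ _ _ (by simp)]
    simp only [List.Vector.toList_length, Nat.add_sub_cancel_left]
    rw [List.getI_eq_getElem _ (by simp), List.Vector.get_eq_get_toList]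
    rfl
  refine ⟨n + j, fun b => b == (enc (stackSymbol false <| mainColumn .bit1)).get j, fun x => ?_⟩
  rw [natTape]
  rcases Nat.mod_two_eq_zero_or_one x with h | h
  · rw [h, key _ .cons ((PartrecToTM2.trNat (x / 2)).reverse) 0 (by simp)]
    rw [Nat.mod_two_of_bodd] at h
    have : x.bodd = false := by cases hb : x.bodd <;> simp_all
    simpa [this] using hj
  · rw [h, key _ .bit1 (.cons :: (PartrecToTM2.trNat (x / 2)).reverse) 1
      (by simp [show PartrecToTM2.trNat 1 = [.bit1] from rfl])]
    rw [Nat.mod_two_of_bodd] at h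
    have : x.bodd = true := by cases hb : x.bodd <;> simp_all
    simp [this]

/-- There is an encoding of the natural numbers by tapes of bits such that every computable function
can be computed by a routine that outputs the parity of the result. -/
theorem exists_encoding : ∃ rep : ℕ → Tape Bool,
    (∃ P : BitRoutine, P.Runs (Tape.mk₁ []) (rep 0) false) ∧
    ∀ f : ℕ → ℕ, Computable f → ∃ P : BitRoutine, ∀ x, P.Runs (rep x) (rep (f x)) (f x).bodd := by
  obtain ⟨n, enc, dec, enc0, encdec⟩ := TM1to1.exists_enc_dec (Γ := StackSymbol)
  obtain ⟨p, g, hp⟩ := exists_readAt_natTape enc0 (Function.LeftInverse.injective encdec)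
  refine ⟨natTape enc0, ?_, fun f hf => ?_⟩
  -- This code maps the empty list to `[0, 0]`, which represents `0`. The tape for the empty list is
  -- not assumed blank, because of the bottom marker, and is written first.
  · obtain ⟨P, hP⟩ := exists_runs_code enc0 encdec (.cons .zero' .zero')
    have hnil : ∃ w, listTape enc0 [] = Tape.mk' (ListBlank.mk []) (ListBlank.mk w) := by
      refine ⟨(enc (stackSymbol true fun _ => none)).toList ++ [], ?_⟩
      have : TM2to1.addBottom (listColumns []) =
        ListBlank.mk (Γ := StackSymbol) [(stackSymbol true fun _ => none)] := rfl
      rw [listTape, TM1to1.trTape_mk', TM1to1.trTape', this, ListBlank.flatMap_mk]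
      rfl
    obtain ⟨w, hw⟩ := hnil
    obtain ⟨b, hb⟩ := exists_runs_writeWord w (ListBlank.mk [])
    have hz : natTape enc0 0 = listTape enc0 [0, 0] := rfl
    refine ⟨(writeWord w).bind fun _ => P, Runs.bind (T' := listTape enc0 []) (b := b) ?_ ?_⟩
    · rw [hw]
      exact hb
    · rw [hz]
      exact hP _ _ (by simp)
  · obtain ⟨c, hc⟩ := exists_code_pair hf
    obtain ⟨P, hP⟩ := exists_runs_code enc0 encdec c
    refine ⟨P.bind fun _ => (readAt p).mapOut g, fun x => ?_⟩
    refine (hP _ _ (by rw [hc]; exact Part.mem_some _)).bind ?_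
    rw [← hp]
    exact (runs_readAt p _).mapOut g

end BitRoutine

/-! ### Machines on numbers and their realisation by reactive Turing machines. -/

/-- A reactive machine whose configurations are a control state and a natural number. A rule is
applicable in its source state if the parity of the number agrees with its guard; it executes an
action and applies a computable function to the number. -/
structure NumMachine (A : Type uA) (C : Type uC) (D : Type uD) where
  State : Type
  Rule : Type
  finite_rule : Finite Rule
  src : Rule → State
  guard : Rule → Bool
  act : Rule → CommActionTau A C D
  fn : Rule → ℕ → ℕ
  computable_fn : ∀ r, Computable (fn r)
  tgt : Rule → State
  init : State
  final : Set State

namespace NumMachine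

open Turing StateTransition

variable {A : Type uA} {C : Type uC} {D : Type uD}

/-- The transition system of a machine on numbers. -/
def lts (N : NumMachine A C D) : TransitionSystem A C D where
  State := N.State × ℕ
  step x a y := ∃ r, N.src r = x.1 ∧ N.guard r = x.2.bodd ∧ N.act r = a ∧ N.tgt r = y.1 ∧
    y.2 = N.fn r x.2
  init := (N.init, 0)
  final := {x | x.1 ∈ N.final}

/-- The state reached by a rule, where `none` stands for the initialisation. -/
def target (N : NumMachine A C D) : Option N.Rule → N.State
  | none => N.init
  | some r => N.tgt r

variable (N : NumMachine A C D) (P : Option N.Rule → BitRoutine) (sym : PointedMap Bool (Option D))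

/-- The states of the realisation of a machine on numbers: the rule that is being executed, the
state of its routine, and whether the head has to return to the left. -/
abbrev RealState : Type := Σ r : Option N.Rule, (P r).State × Bool

/-- The transitions of the realisation of a machine on numbers. -/
inductive RealRel : RealState N P → Option D → CommActionTau A C D → Option D → Dir →
    RealState N P → Prop
  | move {r : Option N.Rule} {q q' : (P r).State} {b : Bool} {d : Dir}
    (h : (P r).next q b = some (q', .move d)) :
    RealRel ⟨r, q, false⟩ (sym b) none (sym b) d ⟨r, q', false⟩
  -- Every step of an RTM moves the head, so an instruction that should stay put steps right and is
  -- completed by `back`.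
  | write {r : Option N.Rule} {q q' : (P r).State} {b b' : Bool}
    (h : (P r).next q b = some (q', .write b')) :
    RealRel ⟨r, q, false⟩ (sym b) none (sym b') .right ⟨r, q', true⟩
  | fire {r : Option N.Rule} {q : (P r).State} {b : Bool} (h : (P r).next q b = none)
    {r' : N.Rule} (hsrc : N.src r' = N.target r) (hguard : N.guard r' = (P r).out q) :
    RealRel ⟨r, q, false⟩ (sym b) (N.act r') (sym b) .right
      ⟨some r', (P (some r')).start, true⟩
  | back {r : Option N.Rule} {q : (P r).State} (b : Bool) :
    RealRel ⟨r, q, true⟩ (sym b) none (sym b) .left ⟨r, q, false⟩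

/-- The reactive Turing machine realising a machine on numbers by means of given routines. -/
def realize : RTM A C D where
  State := RealState N P
  finite_state :=
    haveI := N.finite_rule
    haveI := fun r => (P r).finite_state
    inferInstance
  rel := {x | RealRel N P sym x.1 x.2.1 x.2.2.1 x.2.2.2.1 x.2.2.2.2.1 x.2.2.2.2.2}
  init := ⟨none, (P none).start, false⟩
  final := {s | N.target s.1 ∈ N.final}

variable {N P sym}

theorem realize_step {c c' : (N.realize P sym).lts.State} {a : CommActionTau A C D} :
    (N.realize P sym).lts.step c a c' ↔ ∃ e m,
      RealRel N P sym c.1 c.2.head a e m c'.1 ∧ c'.2 = (c.2.write e).move m :=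
  Iff.rfl

theorem realize_step_back (r : Option N.Rule) (q : (P r).State) (T : Tape Bool) :
    (N.realize P sym).lts.step (⟨r, q, true⟩, (T.map sym).move .right) none
      (⟨r, q, false⟩, T.map sym) := by
  have h : ((T.map sym).move .right).head = sym (T.move .right).head := by
    rw [← Tape.map_move, Tape.map_fst]
  refine realize_step.2 ⟨sym (T.move .right).head, .left, ?_, ?_⟩
  · rw [h]
    exact .back _
  · rw [← h, Tape.write_self, Tape.move_right_left]

theorem realize_tauSteps_single {r : Option N.Rule} {c c' : (P r).State × Tape Bool}
    (h : c' ∈ (P r).step c) : (N.realize P sym).lts.TauSteps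
      (⟨r, c.1, false⟩, c.2.map sym) (⟨r, c'.1, false⟩, c'.2.map sym) := by
  obtain ⟨q, T⟩ := c
  obtain ⟨⟨q', s⟩, hn, rfl⟩ := Option.map_eq_some_iff.1 h
  cases s with
  | move d =>
    refine .single (realize_step.2 ⟨sym T.head, d, ?_, ?_⟩)
    · rw [Tape.map_fst]
      exact .move hn
    · simp only [BitRoutine.effect]
      rw [← Tape.map_fst, Tape.write_self, Tape.map_move]
  | write b =>
    refine .tail (b := (⟨r, q', true⟩, ((T.map sym).write (sym b)).move .right))
      (.single (realize_step.2 ⟨sym b, .right, ?_, rfl⟩)) ?_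
    · rw [Tape.map_fst]
      exact .write hn
    · have := realize_step_back (sym := sym) r q' (T.write b)
      rwa [Tape.map_write] at this

theorem realize_tauSteps {r : Option N.Rule} {c c' : (P r).State × Tape Bool}
    (h : Reaches (P r).step c c') : (N.realize P sym).lts.TauSteps
      (⟨r, c.1, false⟩, c.2.map sym) (⟨r, c'.1, false⟩, c'.2.map sym) := by
  induction h with
  | refl => exact .refl
  | tail _ h ih => exact ih.trans (realize_tauSteps_single h)

/-- A configuration of the realisation is on its way to represent a configuration of the
machine on numbers. -/
def Represents (P : Option N.Rule → BitRoutine) (sym : PointedMap Bool (Option D))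
    (rep : ℕ → Tape Bool)
    (y : N.lts.State) (c : (N.realize P sym).lts.State) : Prop :=
  N.target c.1.1 = y.1 ∧ ∃ T : Tape Bool,
    c.2 = cond c.1.2.2 ((T.map sym).move .right) (T.map sym) ∧
    -- The number represented is the one the running routine will produce, so it changes at the
    -- moment a rule fires and not during the computation.
    ∃ q, Reaches (P c.1.1).step (c.1.2.1, T) (q, rep y.2) ∧
      (P c.1.1).next q (rep y.2).head = none ∧ (P c.1.1).out q = y.2.bodd

/-- The pending routine is run to its end, which preserves the represented configuration, and then
the rule fires. -/
theorem Represents.step_left {rep : ℕ → Tape Bool}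
    (hP : ∀ r x, (P (some r)).Runs (rep x) (rep (N.fn r x)) (N.fn r x).bodd)
    {y y' : N.lts.State} {c : (N.realize P sym).lts.State} (h : Represents P sym rep y c)
    {a : CommActionTau A C D} (hs : N.lts.step y a y') :
    ∃ c'' c', (N.realize P sym).lts.TauSteps c c'' ∧ (N.realize P sym).lts.OptStep c'' a c' ∧
      Represents P sym rep y c'' ∧ Represents P sym rep y' c' := by
  obtain ⟨y, x⟩ := y
  obtain ⟨⟨r, q, ph⟩, U⟩ := c
  obtain ⟨rfl, T, hU, q', hreach, hn, hout⟩ := h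
  obtain ⟨r', hsrc, hguard, rfl, htgt, hy'⟩ := hs
  simp only at hU hreach hn hout hsrc hguard hy'
  refine ⟨(⟨r, q', false⟩, (rep x).map sym),
    (⟨some r', (P (some r')).start, true⟩, ((rep x).map sym).move .right),
    .trans ?_ (realize_tauSteps hreach), .inl (realize_step.2 ⟨sym (rep x).head, .right, ?_, ?_⟩),
    ⟨rfl, rep x, rfl, q', .refl, hn, hout⟩, htgt, rep x, rfl, ?_⟩
  · subst hU
    cases ph
    · exact .refl
    · exact .single (realize_step_back r q T)
  · rw [Tape.map_fst]
    exact .fire hn hsrc (hguard.trans hout.symm)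
  · simp only
    rw [← Tape.map_fst, Tape.write_self]
  · rw [hy']
    exact hP r' x

/-- A step of the realisation either advances a deterministic run or fires a rule; the former is
matched by standing still. Injectivity of `sym` recovers the scanned bit from the tape symbol. -/
theorem Represents.step_right (hsym : Function.Injective sym) {rep : ℕ → Tape Bool}
    (hP : ∀ r x, (P (some r)).Runs (rep x) (rep (N.fn r x)) (N.fn r x).bodd)
    {y : N.lts.State} {c c' : (N.realize P sym).lts.State} (h : Represents P sym rep y c)
    {a : CommActionTau A C D} (hs : (N.realize P sym).lts.step c a c') :
    ∃ y', N.lts.OptStep y a y' ∧ Represents P sym rep y' c' := by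
  obtain ⟨y, x⟩ := y
  obtain ⟨s, U⟩ := c
  obtain ⟨s', U'⟩ := c'
  obtain ⟨hy, T, hU, q', hreach, hn, hout⟩ := h
  obtain ⟨e, m, hrel, hU'⟩ := realize_step.1 hs
  simp only at hy hU hreach hn hout hU' hrel
  generalize hd : U.head = d at hrel
  cases hrel with
  | @move r q p b m hnext =>
    obtain rfl : U = T.map sym := hU
    rw [Tape.map_fst] at hd
    obtain rfl := hsym hd
    refine ⟨(y, x), .inr ⟨rfl, rfl⟩, hy, T.move m, ?_, q', ?_, hn, hout⟩
    · simp only [cond_false]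
      rw [hU', ← Tape.map_fst, Tape.write_self, Tape.map_move]
    -- The run cannot be over, as an instruction applies; by determinism its first step is the one
    -- just taken.
    · rcases hreach.cases_head with heq | ⟨z, hz, hreach⟩
      · cases heq
        rw [hn] at hnext
        cases hnext
      · simp only [BitRoutine.step, hnext, Option.map_some, Option.mem_def, Option.some.injEq] at hz
        subst hz
        exact hreach
  | @write r q p b b' hnext =>
    obtain rfl : U = T.map sym := hU
    rw [Tape.map_fst] at hd
    obtain rfl := hsym hd
    refine ⟨(y, x), .inr ⟨rfl, rfl⟩, hy, T.write b', ?_, q', ?_, hn, hout⟩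
    · simp only [cond_true]
      rw [hU', Tape.map_write]
    · rcases hreach.cases_head with heq | ⟨z, hz, hreach⟩
      · cases heq
        rw [hn] at hnext
        cases hnext
      · simp only [BitRoutine.step, hnext, Option.map_some, Option.mem_def, Option.some.injEq] at hz
        subst hz
        exact hreach
  | @fire r q b hnext r' hsrc hguard =>
    obtain rfl : U = T.map sym := hU
    rw [Tape.map_fst] at hd
    obtain rfl := hsym hd
    -- A rule fires only in a halting state, so the run is over and the tape is `rep x`.
    rcases hreach.cases_head with heq | ⟨z, hz, -⟩
    · cases heq
      refine ⟨(N.tgt r', N.fn r' x), .inl ⟨r', hsrc.trans hy, hguard.trans hout, rfl, rfl, rfl⟩,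
        rfl, rep x, ?_, hP r' x⟩
      simp only [cond_true]
      rw [hU', ← Tape.map_fst, Tape.write_self]
    · simp [BitRoutine.step, hnext] at hz
  | @back r q b =>
    obtain rfl : U = (T.map sym).move .right := hU
    refine ⟨(y, x), .inr ⟨rfl, rfl⟩, hy, T, ?_, q', hreach, hn, hout⟩
    simp only [cond_false]
    rw [hU', ← hd, Tape.write_self, Tape.move_right_left]

/-- Bits as tape symbols. -/
def bitSymbol (one : D) : PointedMap Bool (Option D) := ⟨fun b => cond b (some one) none, rfl⟩

theorem bitSymbol_injective (one : D) : Function.Injective (bitSymbol one) := by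
  rintro (_ | _) (_ | _) h <;> first | rfl | cases h

/-- Every machine on numbers is realised by a reactive Turing machine. -/
theorem exists_branchingBisimilar_rtm (N : NumMachine A C D) (one : D) :
    ∃ U : RTM.{uA, uC, uD, 0} A C D, TransitionSystem.BranchingBisimilar N.lts U.lts := by
  obtain ⟨rep, ⟨B, hB⟩, hrep⟩ := BitRoutine.exists_encoding
  choose F hF using fun r => hrep _ (N.computable_fn r)
  let P : Option N.Rule → BitRoutine := fun r => r.elim B F
  have hB' : B.Runs (Tape.mk₁ []) (rep 0) (Nat.bodd 0) := by rwa [Nat.bodd_zero]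
  refine ⟨N.realize P (bitSymbol one), Represents P (bitSymbol one) rep, ⟨?_, ?_, ?_, ?_⟩, ?_⟩
  · intro y c h a y' hs
    exact h.step_left hF hs
  · intro y c h a c' hs
    obtain ⟨y', hopt, hr⟩ := h.step_right (bitSymbol_injective one) hF hs
    exact ⟨y, y', .refl, hopt, h, hr⟩
  · intro y c h hy
    refine ⟨c, .refl, h, ?_⟩
    change N.target c.1.1 ∈ N.final
    rw [h.1]
    exact hy
  · intro y c h hc
    refine ⟨y, .refl, h, ?_⟩
    change y.1 ∈ N.final
    rw [← h.1]
    exact hc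
  · exact ⟨rfl, Tape.mk₁ [], by simp [realize, RTM.lts, Tape.map_mk₁], hB'⟩

end NumMachine

/-! ### Arithmetic of the simulation. -/

namespace UniversalMachine

/-- A configuration in numbers: the state, the scanned symbol, and the symbols to the left and to
the right of the head. -/
abbrev CodedConfig : Type := ℕ × ℕ × List ℕ × List ℕ

/-- The data of a simulation in numbers: the final states, the transitions, the configuration and a
candidate for the next transition. -/
abbrev SimData : Type := List ℕ × List ℕ × CodedConfig × ℕ

/-- A transition in numbers. -/
abbrev CodedTransition : Type := ℕ × ℕ × ℕ × ℕ × ℕ × ℕ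

/-- The transition with a given number. -/
def decodeTransition (i : ℕ) : CodedTransition := (Encodable.decode i).getD default

/-- Does the label `g` apply? The label `some a` stands for the execution of the candidate
transition with action number `a`, and `none` for termination. -/
def enabled (g : Option ℕ) (y : SimData) : Bool :=
  match g with
  -- Membership in a list, written so as to be visibly primitive recursive.
  | none => decide (y.1.idxOf y.2.2.1.1 < y.1.length)
  | some a => decide (y.2.1.idxOf y.2.2.2 < y.2.1.length) &&
      (((decodeTransition y.2.2.2).1 == y.2.2.1.1) &&
        (((decodeTransition y.2.2.2).2.1 == y.2.2.1.2.1) &&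
          ((decodeTransition y.2.2.2).2.2.1 == a)))

/-- The number representing `y` with a flag telling whether `g` applies. -/
def pack (g : Option ℕ) (y : SimData) : ℕ :=
  bif enabled g y then 2 * Encodable.encode y + 1 else 2 * Encodable.encode y

/-- The data represented by a number. -/
def unpack (x : ℕ) : SimData := (Encodable.decode x.div2).getD default

/-- Execute a coded transition. -/
def moveConfig (τ : CodedTransition) (c : CodedConfig) : CodedConfig :=
  -- Direction `0` is left. On an empty list `headI` yields `0`, the code of the blank.
  bif τ.2.2.2.2.1 == 0 then (τ.2.2.2.2.2, c.2.2.1.headI, c.2.2.1.tail, τ.2.2.2.1 :: c.2.2.2)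
  else (τ.2.2.2.2.2, c.2.2.2.headI, τ.2.2.2.1 :: c.2.2.1, c.2.2.2.tail)

/-- Execute the candidate transition. -/
def execute (y : SimData) : SimData :=
  (y.1, y.2.1, moveConfig (decodeTransition y.2.2.2) y.2.2.1, y.2.2.2)

/-- Replace the candidate transition by the next one or by the first one. -/
def nextCandidate (incr : Bool) (y : SimData) : SimData :=
  (y.1, y.2.1, y.2.2.1, bif incr then y.2.2.2 + 1 else 0)

/-- The data at the start of a simulation of the machine with number `k`. -/
def initData (k : ℕ) : SimData :=
  let p : ℕ × ℕ × List ℕ × List ℕ := (Encodable.decode k).getD default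
  -- The scanned symbol `0` is the blank; the initial candidate `0` is arbitrary.
  (p.2.2.1, p.2.2.2, (p.2.1, 0, [], []), 0)

theorem pack_eq_bit (g : Option ℕ) (y : SimData) :
    pack g y = Nat.bit (enabled g y) (Encodable.encode y) := by
  rw [pack, Nat.bit_val]
  cases enabled g y <;> rfl

@[simp]
theorem unpack_pack (g : Option ℕ) (y : SimData) : unpack (pack g y) = y := by
  rw [pack_eq_bit, unpack, Nat.div2_bit, Encodable.encodek, Option.getD_some]

@[simp]
theorem bodd_pack (g : Option ℕ) (y : SimData) : (pack g y).bodd = enabled g y := by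
  rw [pack_eq_bit, Nat.bodd_bit]

section Primrec

open Primrec

theorem primrec_decodeTransition : Primrec decodeTransition :=
  option_getD.comp .decode (.const _)

theorem primrec_idxOf_lt {f : SimData → List ℕ} {g : SimData → ℕ} (hf : Primrec f)
    (hg : Primrec g) : Primrec fun y => decide ((f y).idxOf (g y) < (f y).length) :=
  (nat_lt.comp (list_idxOf.comp hg hf) (list_length.comp hf)).decide

theorem primrec_enabled (g : Option ℕ) : Primrec (enabled g) := by
  have hc : Primrec fun y : SimData => y.2.2.1 := fst.comp (snd.comp snd)
  have hi : Primrec fun y : SimData => y.2.2.2 := snd.comp (snd.comp snd)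
  cases g with
  | none => exact primrec_idxOf_lt fst (fst.comp hc)
  | some a =>
    have ht := primrec_decodeTransition.comp hi
    exact Primrec.and.comp (primrec_idxOf_lt (fst.comp snd) hi)
      (Primrec.and.comp (Primrec.beq.comp (fst.comp ht) (fst.comp hc))
        (Primrec.and.comp (Primrec.beq.comp (fst.comp (snd.comp ht)) (fst.comp (snd.comp hc)))
          (Primrec.beq.comp (fst.comp (snd.comp (snd.comp ht))) (.const a))))

theorem primrec_pack (g : Option ℕ) : Primrec (pack g) :=
  .cond (primrec_enabled g) (nat_double_succ.comp .encode) (nat_double.comp .encode)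

theorem primrec_unpack : Primrec unpack :=
  option_getD.comp (Primrec.decode.comp nat_div2) (.const _)

theorem primrec_moveConfig : Primrec₂ moveConfig := by
  have ht : Primrec fun p : CodedTransition × CodedConfig => p.1.2.2.2 :=
    snd.comp (snd.comp (snd.comp fst))
  have he := fst.comp ht
  have hs := snd.comp (snd.comp ht)
  have hl : Primrec fun p : CodedTransition × CodedConfig => p.2.2.2.1 :=
    fst.comp (snd.comp (snd.comp snd))
  have hr : Primrec fun p : CodedTransition × CodedConfig => p.2.2.2.2 :=
    snd.comp (snd.comp (snd.comp snd))
  exact .cond (Primrec.beq.comp (fst.comp (snd.comp ht)) (.const 0))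
    (hs.pair ((list_headI.comp hl).pair ((list_tail.comp hl).pair (list_cons.comp he hr))))
    (hs.pair ((list_headI.comp hr).pair ((list_cons.comp he hl).pair (list_tail.comp hr))))

theorem primrec_execute : Primrec execute := by
  have hi : Primrec fun y : SimData => y.2.2.2 := snd.comp (snd.comp snd)
  exact fst.pair ((fst.comp snd).pair (.pair
    (primrec_moveConfig.comp (primrec_decodeTransition.comp hi) (fst.comp (snd.comp snd))) hi))

theorem primrec_nextCandidate (incr : Bool) : Primrec (nextCandidate incr) := by
  have hi : Primrec fun y : SimData => y.2.2.2 := snd.comp (snd.comp snd)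
  exact fst.pair ((fst.comp snd).pair ((fst.comp (snd.comp snd)).pair
    (.cond (.const incr) (succ.comp hi) (.const 0))))

theorem primrec_initData : Primrec initData := by
  have hp : Primrec fun k : ℕ =>
      ((Encodable.decode k).getD default : ℕ × ℕ × List ℕ × List ℕ) :=
    option_getD.comp .decode (.const _)
  have hq := snd.comp (snd.comp hp)
  exact (fst.comp hq).pair ((snd.comp hq).pair
    (.pair ((fst.comp (snd.comp hp)).pair (.const _)) (.const 0)))

end Primrec

/-! ### The control of the universal machine. -/

variable {A : Type uA} {C : Type uC} {D : Type uD}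

/-- The control states: waiting for the number, counting, trying a label, and terminated. Labels are
actions, numbered by `Fin N`, and `none` for termination. -/
inductive Control (N : ℕ) : Type
  | wait
  | count
  | loop (g : Option (Fin N))
  | halted

/-- The rules of the universal machine, parameterised by the value of the guard if it does not
matter. -/
inductive Instr (N : ℕ) : Type
  | opening (b : Bool)
  | digit (b : Bool)
  | closing (b : Bool)
  | next (b : Bool) (g g' : Option (Fin N)) (incr : Bool)
  | exec (j : Fin N)
  | halt
  | resume (b : Bool)

/-- The rules as elements of a finite type. -/
def Instr.toSum (N : ℕ) : Instr N → (Fin 4 × Bool) ⊕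
    (Bool × Option (Fin N) × Option (Fin N) × Bool) ⊕ Fin N ⊕ Unit
  | .opening b => .inl (0, b)
  | .digit b => .inl (1, b)
  | .closing b => .inl (2, b)
  | .resume b => .inl (3, b)
  | .next b g g' i => .inr (.inl (b, g, g', i))
  | .exec j => .inr (.inr (.inl j))
  | .halt => .inr (.inr (.inr ()))

instance (N : ℕ) : Finite (Instr N) :=
  Finite.of_injective (Instr.toSum N) (by
    rintro (_ | _ | _ | _ | _ | _ | _) (_ | _ | _ | _ | _ | _ | _) h <;>
      simp_all [Instr.toSum])

variable [Encodable A] [Encodable C] [Encodable D] {N : ℕ}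

/-- The number of a label. -/
def labelCode (e : CommActionTau A C D ≃ Fin N) (g : Option (Fin N)) : Option ℕ :=
  g.map fun j => Encodable.encode (e.symm j)

/-- The universal machine on numbers. -/
def machine (u : C) (one lb rb : D) (e : CommActionTau A C D ≃ Fin N) : NumMachine A C D where
  State := Control N
  Rule := Instr N
  finite_rule := inferInstance
  src
    | .opening _ => .wait
    | .digit _ => .count
    | .closing _ => .count
    | .next _ g _ _ => .loop g
    | .exec j => .loop (some j)
    | .halt => .loop none
    | .resume _ => .halted
  guard
    | .opening b => b
    | .digit b => b
    | .closing b => b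
    | .next b _ _ _ => b
    | .exec _ => true
    | .halt => true
    | .resume b => b
  act
    | .opening _ => some (.recv u (some lb))
    | .digit _ => some (.recv u (some one))
    | .closing _ => some (.recv u (some rb))
    | .exec j => e.symm j
    | _ => none
  fn
    | .opening _ => id
    | .digit _ => Nat.succ
    -- The number `k` arrives as `k + 1` digits, hence the predecessor.
    | .closing _ => fun x => pack none (initData x.pred)
    -- Guards see only the parity, so the test for the label `g'` is computed on entering its
    -- control state.
    | .next _ _ g' i => fun x => pack (labelCode e g') (nextCandidate i (unpack x))
    | .exec _ => fun x => pack none (execute (unpack x))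
    | .halt => id
    | .resume _ => id
  computable_fn
    | .opening _ => Computable.id
    | .digit _ => Computable.succ
    | .closing _ => ((primrec_pack _).comp (primrec_initData.comp Primrec.pred)).to_comp
    | .next _ _ _ i =>
      ((primrec_pack _).comp ((primrec_nextCandidate i).comp primrec_unpack)).to_comp
    | .exec _ => ((primrec_pack _).comp (primrec_execute.comp primrec_unpack)).to_comp
    | .halt => Computable.id
    | .resume _ => Computable.id
  tgt
    | .opening _ => .count
    | .digit _ => .count
    | .closing _ => .loop none
    | .next _ _ g' _ => .loop g'
    | .exec _ => .loop none
    | .halt => .halted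
    -- A final configuration of the simulated machine may have outgoing transitions, so `halted`
    -- must not be a dead end.
    | .resume _ => .loop none
  init := .wait
  final := {.halted}

end UniversalMachine

/-- The sender's tape is thus the same blank tape after each transmission. -/
theorem Turing.Tape.write_move_mk₁_nil {Γ : Type*} [Inhabited Γ] :
    ((Turing.Tape.mk₁ ([] : List Γ)).write default).move .right = Turing.Tape.mk₁ [] := by
  simp only [Turing.Tape.mk₁, Turing.Tape.mk₂, Turing.Tape.write_mk', Turing.Tape.move_right_mk',
    Turing.ListBlank.head_cons, Turing.ListBlank.tail_cons, Turing.ListBlank.tail_mk]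
  congr 1
  exact Turing.ListBlank.cons_head_tail (Turing.ListBlank.mk ([] : List Γ))

/-! ### Correctness of the coded configurations and the simulation relation. -/

namespace UniversalMachine

open Turing

variable {A : Type uA} {C : Type uC} {D : Type uD}
variable {N : ℕ} {u : C} {one lb rb : D} {e : CommActionTau A C D ≃ Fin N}
variable {M : RTM.{uA, uC, uD, v} A C D} {n : ℕ} {ν : M.State ≃ Fin n}

/-- The word sent for the number `k`. -/
abbrev numberWord (one lb rb : D) (k : ℕ) : List D := [lb] ++ List.replicate (k + 1) one ++ [rb]

theorem numberWord_get (k : ℕ) (i : Fin (numberWord one lb rb k).length) :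
    (numberWord one lb rb k).get i =
      if (i : ℕ) = 0 then lb else if (i : ℕ) ≤ k + 1 then one else rb := by
  obtain ⟨i, hi⟩ := i
  simp only [List.length_append, List.length_cons, List.length_nil, List.length_replicate] at hi
  rcases i with _ | i
  · simp
  · by_cases h : i ≤ k
    · simp [h, Nat.lt_succ_of_le h]
    · obtain rfl : i = k + 1 := by omega
      simp

variable [Encodable A] [Encodable C] [Encodable D]

/-- The labels can be tried in any order, with any candidate. -/
theorem machine_tauSteps_loop (g g' : Option (Fin N)) (y : SimData) (i : ℕ) :
    (machine u one lb rb e).lts.TauSteps (.loop g, pack (labelCode e g) y)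
      (.loop g', pack (labelCode e g') (y.1, y.2.1, y.2.2.1, i)) := by
  induction i generalizing g' with
  | zero =>
    -- The candidate is first reset to `0`, then incremented up to the desired value.
    exact .single ⟨.next _ g g' false, rfl, rfl, rfl, rfl,
      by simp only [machine, unpack_pack, nextCandidate, cond_false]⟩
  | succ i ih =>
    exact (ih g).tail ⟨.next _ g g' true, rfl, rfl, rfl, rfl,
      by simp only [machine, unpack_pack, nextCandidate, cond_true]⟩

/-- The code of a tuple depends only on the codes of its components, so the components can be read
off as numbers. -/
theorem decodeTransition_transCode (s : M.State) (d : Option D) (a : CommActionTau A C D)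
    (d' : Option D) (m : Dir) (t : M.State) :
    decodeTransition (RTM.transCode ν (s, d, a, d', m, t)) = ((ν s : ℕ), Encodable.encode d,
      Encodable.encode a, Encodable.encode d', Encodable.encode (dirEquivBool m), (ν t : ℕ)) := by
  have : RTM.transCode ν (s, d, a, d', m, t) = Encodable.encode (((ν s : ℕ), Encodable.encode d,
      Encodable.encode a, Encodable.encode d', Encodable.encode (dirEquivBool m), (ν t : ℕ)) :
        CodedTransition) := rfl
  rw [this, decodeTransition, Encodable.encodek, Option.getD_some]

theorem encode_headI (L : List (Option D)) :
    (L.map Encodable.encode).headI = Encodable.encode L.headI := by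
  cases L <;> rfl

variable [Finite A] [Finite C] [Finite D]

attribute [local irreducible] RTM.transCode decodeTransition

/-- The coded configuration `y` represents the configuration `c`. -/
def RepresentsConfig (ν : M.State ≃ Fin n) (c : M.lts.State) (y : CodedConfig) : Prop :=
  -- The lists are determined only up to trailing blanks, so a configuration has many codes.
  ∃ L R : List (Option D), c.2.left = ListBlank.mk L ∧ c.2.right = ListBlank.mk R ∧
    y = ((ν c.1 : ℕ), Encodable.encode c.2.head, L.map Encodable.encode, R.map Encodable.encode)

/-- The data `y` represent the machine `M` in configuration `c`. -/
def RepresentsData (ν : M.State ≃ Fin n) (c : M.lts.State) (y : SimData) : Prop :=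
  y.1 = (M.finalCodes ν).sort (· ≤ ·) ∧ y.2.1 = (M.transCodes ν).sort (· ≤ ·) ∧
    RepresentsConfig ν c y.2.2.1

theorem representsData_initData : RepresentsData ν M.lts.init (initData (M.godelNumber ν)) := by
  have : initData (M.godelNumber ν) = ((M.finalCodes ν).sort (· ≤ ·),
      (M.transCodes ν).sort (· ≤ ·), ((ν M.init : ℕ), 0, [], []), 0) := by
    rw [initData, RTM.godelNumber, Encodable.encodek]
    rfl
  rw [this]
  exact ⟨rfl, rfl, [], [], rfl, rfl, rfl⟩

theorem RepresentsData.nextCandidate {c : M.lts.State} {y : SimData} (h : RepresentsData ν c y)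
    (i : Bool) : RepresentsData ν c (nextCandidate i y) := h

theorem RepresentsData.execute {c : M.lts.State} {y : SimData} (h : RepresentsData ν c y)
    {s d a : ℕ} {d' : Option D} {m : Dir} {t : M.State} (hy : decodeTransition y.2.2.2 =
      (s, d, a, Encodable.encode d', Encodable.encode (dirEquivBool m), (ν t : ℕ))) :
    RepresentsData ν (t, (c.2.write d').move m) (execute y) := by
  obtain ⟨h₁, h₂, L, R, hL, hR, h₃⟩ := h
  obtain ⟨s₀, ⟨hd, l, r⟩⟩ := c
  simp only at hL hR h₃
  subst hL hR
  have h₄ : (UniversalMachine.execute y).2.2.1 =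
      moveConfig (s, d, a, Encodable.encode d', Encodable.encode (dirEquivBool m), (ν t : ℕ))
        ((ν s₀ : ℕ), Encodable.encode hd, L.map Encodable.encode, R.map Encodable.encode) := by
    rw [← hy, ← h₃]
    rfl
  refine ⟨h₁, h₂, ?_⟩
  rw [h₄]
  cases m with
  | left =>
    refine ⟨L.tail, d' :: R, rfl, rfl, ?_⟩
    simp [moveConfig, encode_headI, dirEquivBool, Tape.move, Tape.write]
  | right =>
    refine ⟨d' :: L, R.tail, rfl, rfl, ?_⟩
    simp [moveConfig, encode_headI, dirEquivBool, Tape.move, Tape.write]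

theorem RepresentsData.mem_final_iff {c : M.lts.State} {y : SimData} (h : RepresentsData ν c y) :
    enabled none y = true ↔ c ∈ M.lts.final := by
  obtain ⟨h₁, -, L, R, -, -, h₃⟩ := h
  rw [enabled, decide_eq_true_iff, List.idxOf_lt_length_iff, h₁, h₃, Finset.mem_sort,
    RTM.finalCodes, Set.Finite.mem_toFinset]
  simp only [Set.mem_image]
  constructor
  · rintro ⟨s, hs, heq⟩
    obtain rfl := ν.injective (Fin.ext heq)
    exact hs
  · exact fun hc => ⟨c.1, hc, rfl⟩

theorem mem_transCodes_iff {x : ℕ} :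
    x ∈ (M.transCodes ν).sort (· ≤ ·) ↔ ∃ p ∈ M.rel, RTM.transCode ν p = x := by
  rw [Finset.mem_sort, RTM.transCodes, Set.Finite.mem_toFinset]
  rfl

/-- The candidate is the number of some transition of `M`; injectivity of the numberings identifies
its source, scanned symbol and action with the current ones. -/
theorem RepresentsData.exists_step {c : M.lts.State} {y : SimData} (h : RepresentsData ν c y)
    {a : CommActionTau A C D} (hy : enabled (some (Encodable.encode a)) y = true) :
    ∃ c', M.lts.step c a c' ∧ RepresentsData ν c' (UniversalMachine.execute y) := by
  have h' := h
  obtain ⟨-, h₂, L, R, -, -, h₃⟩ := h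
  simp only [enabled, Bool.and_eq_true, decide_eq_true_iff, List.idxOf_lt_length_iff, beq_iff_eq]
    at hy
  obtain ⟨hi, hs, hd, ha⟩ := hy
  rw [h₂, mem_transCodes_iff] at hi
  obtain ⟨⟨s, d, a', d', m, t⟩, hrel, hi⟩ := hi
  rw [← hi, decodeTransition_transCode] at hs hd ha
  rw [h₃] at hs hd
  obtain rfl := ν.injective (Fin.ext hs)
  obtain rfl := Encodable.encode_injective hd
  obtain rfl := Encodable.encode_injective ha
  exact ⟨(t, (c.2.write d').move m), ⟨d', m, hrel, rfl⟩,
    h'.execute (hi ▸ decodeTransition_transCode ..)⟩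

/-- The candidate is the number of the very transition used in the step. -/
theorem RepresentsData.exists_candidate {c c' : M.lts.State} {y : SimData}
    (h : RepresentsData ν c y) {a : CommActionTau A C D} (hs : M.lts.step c a c') :
    ∃ i, enabled (some (Encodable.encode a)) (y.1, y.2.1, y.2.2.1, i) = true ∧
      RepresentsData ν c' (UniversalMachine.execute (y.1, y.2.1, y.2.2.1, i)) := by
  have h' := h
  obtain ⟨-, h₂, L, R, -, -, h₃⟩ := h
  obtain ⟨d', m, hrel, hc'⟩ := hs
  obtain ⟨t, T⟩ := c'
  obtain rfl : T = _ := hc'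
  refine ⟨RTM.transCode ν (c.1, c.2.head, a, d', m, t), ?_, ?_⟩
  · simp only [enabled, Bool.and_eq_true, decide_eq_true_iff, List.idxOf_lt_length_iff, beq_iff_eq]
    rw [h₂, mem_transCodes_iff, decodeTransition_transCode, h₃]
    exact ⟨⟨_, hrel, rfl⟩, rfl, rfl, rfl⟩
  · exact RepresentsData.execute (y := (y.1, y.2.1, y.2.2.1,
      RTM.transCode ν (c.1, c.2.head, a, d', m, t))) h' (decodeTransition_transCode ..)

/-- The simulation relation between `M` and the universal machine supplied with the number `k`. -/
inductive Sim (u : C) (one lb rb : D) (e : CommActionTau A C D ≃ Fin N) (ν : M.State ≃ Fin n)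
    (k : ℕ) : M.lts.State → (TransitionSystem.parallel {u} (RTM.sendNumber A u one lb rb k).lts
      (machine u one lb rb e).lts).State → Prop
  | wait : Sim u one lb rb e ν k M.lts.init (((0 : Fin (_ + 1)), Tape.mk₁ []), (.wait, 0))
  | count (m : ℕ) (hm : m ≤ k + 1) (j : Fin ((numberWord one lb rb k).length + 1))
      (hj : (j : ℕ) = m + 1) :
      Sim u one lb rb e ν k M.lts.init ((j, Tape.mk₁ []), (.count, m))
  -- Neither the label nor the candidate in `y` is constrained: all stages of the search for `c` are
  -- related to `c`.
  | loop {c : M.lts.State} {y : SimData} (h : RepresentsData ν c y) (T : Tape (Option D))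
      (g : Option (Fin N)) :
      Sim u one lb rb e ν k c ((Fin.last _, T), (.loop g, pack (labelCode e g) y))
  | halted {c : M.lts.State} {y : SimData} (h : RepresentsData ν c y) (T : Tape (Option D))
      (hy : enabled none y = true) :
      Sim u one lb rb e ν k c ((Fin.last _, T), (.halted, pack none y))

end UniversalMachine

/-! ### The simulation relation is a branching bisimulation. -/

namespace UniversalMachine

open Turing TransitionSystem

variable {A : Type uA} {C : Type uC} {D : Type uD}
variable {N : ℕ} {u : C} {one lb rb : D} {e : CommActionTau A C D ≃ Fin N}
variable {M : RTM.{uA, uC, uD, v} A C D} {n : ℕ} {ν : M.State ≃ Fin n}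

theorem sendNumber_step_iff {k : ℕ} {p p' : (RTM.sendNumber A u one lb rb k).lts.State}
    {a : CommActionTau A C D} : (RTM.sendNumber A u one lb rb k).lts.step p a p' ↔
      ∃ i : Fin (numberWord one lb rb k).length, p.1 = i.castSucc ∧ p.2.head = none ∧
        a = some (.send u (some ((numberWord one lb rb k).get i))) ∧ p'.1 = i.succ ∧
        p'.2 = (p.2.write none).move .right := by
  constructor
  · rintro ⟨d, m, ⟨i, hi⟩, hp'⟩
    obtain rfl : d = none := congrArg (·.2.2.2.1) hi
    obtain rfl : m = .right := congrArg (·.2.2.2.2.1) hi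
    exact ⟨i, congrArg (·.1) hi, congrArg (·.2.1) hi, congrArg (·.2.2.1) hi,
      congrArg (·.2.2.2.2.2) hi, hp'⟩
  · rintro ⟨i, h₁, h₂, rfl, h₃, h₄⟩
    exact ⟨none, .right, ⟨i, by rw [h₁, h₂, h₃]; rfl⟩, h₄⟩

theorem not_step_sendNumber_last {k : ℕ} {T : Tape (Option D)} {a : CommActionTau A C D}
    {p' : (RTM.sendNumber A u one lb rb k).lts.State} :
    ¬ (RTM.sendNumber A u one lb rb k).lts.step
      ((Fin.last _ : Fin ((numberWord one lb rb k).length + 1)), T) a p' := by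
  intro h
  obtain ⟨i, hi, -⟩ := sendNumber_step_iff.1 h
  exact (Fin.castSucc_lt_last i).ne hi.symm

theorem communicatesOn_send (d : Option D) :
    CommunicatesOn {u} (some (.send u d) : CommActionTau A C D) :=
  ⟨u, rfl, d, .inl rfl⟩

theorem communicatesOn_recv (d : Option D) :
    CommunicatesOn {u} (some (.recv u d) : CommActionTau A C D) :=
  ⟨u, rfl, d, .inr rfl⟩

variable [Encodable A] [Encodable C] [Encodable D]

/-- The transmission of a symbol to the universal machine. -/
theorem parallel_step_transmit {k : ℕ} (i : Fin (numberWord one lb rb k).length)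
    {x y : (machine u one lb rb e).lts.State} (h : (machine u one lb rb e).lts.step x
      (some (.recv u (some ((numberWord one lb rb k).get i)))) y) :
    (parallel {u} (RTM.sendNumber A u one lb rb k).lts (machine u one lb rb e).lts).step
      ((i.castSucc, Tape.mk₁ []), x) none ((i.succ, Tape.mk₁ []), y) :=
  ⟨not_communicatesOn_none _, .inr ⟨rfl, u, rfl, _, .inl ⟨sendNumber_step_iff.2
    ⟨i, rfl, rfl, rfl, rfl, Tape.write_move_mk₁_nil.symm⟩, h⟩⟩⟩

/-- A step of the parallel composition before the last symbol has been sent is a transmission, if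
the universal machine can only receive. -/
theorem parallel_step_inv {k : ℕ} {p p' : (RTM.sendNumber A u one lb rb k).lts.State}
    {x x' : (machine u one lb rb e).lts.State} {a : CommActionTau A C D}
    (h : (parallel {u} (RTM.sendNumber A u one lb rb k).lts (machine u one lb rb e).lts).step
      (p, x) a (p', x'))
    (hx : ∀ b, (machine u one lb rb e).lts.step x b x' → ∃ d, b = some (.recv u d)) :
    a = none ∧ ∃ i : Fin (numberWord one lb rb k).length, p.1 = i.castSucc ∧ p'.1 = i.succ ∧
      p'.2 = (p.2.write none).move .right ∧ (machine u one lb rb e).lts.step x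
        (some (.recv u (some ((numberWord one lb rb k).get i)))) x' := by
  obtain ⟨hK, (⟨hp, -⟩ | ⟨hs, -⟩) | ⟨ha, c, hc, d, ⟨hp, hs⟩ | ⟨hp, -⟩⟩⟩ := h
  · obtain ⟨i, -, -, rfl, -⟩ := sendNumber_step_iff.1 hp
    exact absurd (communicatesOn_send _) hK
  · obtain ⟨d, rfl⟩ := hx _ hs
    exact absurd (communicatesOn_recv _) hK
  · obtain ⟨i, h₁, -, h₂, h₃, h₄⟩ := sendNumber_step_iff.1 hp
    cases h₂
    exact ⟨ha, i, h₁, h₃, h₄, hs⟩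
  · obtain ⟨i, -, -, h₂, -⟩ := sendNumber_step_iff.1 hp
    cases h₂

/-- A step of the parallel composition after the last symbol has been sent is a step of the
universal machine. -/
theorem parallel_step_last {k : ℕ} {T : Tape (Option D)}
    {p' : (RTM.sendNumber A u one lb rb k).lts.State}
    {x x' : (machine u one lb rb e).lts.State} {a : CommActionTau A C D}
    (h : (parallel {u} (RTM.sendNumber A u one lb rb k).lts (machine u one lb rb e).lts).step
      (((Fin.last _ : Fin ((numberWord one lb rb k).length + 1)), T), x) a (p', x')) :
    (machine u one lb rb e).lts.step x a x' ∧ p' = (Fin.last _, T) := by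
  obtain ⟨hK, (⟨hp, -⟩ | ⟨hs, hp⟩) | ⟨ha, c, hc, d, ⟨hp, -⟩ | ⟨hp, -⟩⟩⟩ := h
  · exact absurd hp not_step_sendNumber_last
  · exact ⟨hs, hp.symm⟩
  · exact absurd hp not_step_sendNumber_last
  · exact absurd hp not_step_sendNumber_last

variable {k : ℕ}

attribute [local irreducible] pack execute nextCandidate initData enabled

theorem tauSteps_count (r m : ℕ) (hm : m + r = k + 1)
    (j : Fin ((numberWord one lb rb k).length + 1)) (hj : (j : ℕ) = m + 1) :
    (parallel {u} (RTM.sendNumber A u one lb rb k).lts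
      (machine u one lb rb e).lts).TauSteps ((j, Tape.mk₁ []), (.count, m))
        ((Fin.last _, Tape.mk₁ []), (.loop none, pack none (initData k))) := by
  have hlen : (numberWord one lb rb k).length = k + 3 := by
    simp
  induction r generalizing m j with
  | zero =>
    obtain rfl : m = k + 1 := hm
    -- The opening bracket has index `0` and the digits have indices `1` to `k + 1`, so the closing
    -- bracket has index `k + 2`.
    have hi : k + 2 < (numberWord one lb rb k).length := by omega
    have hget : (numberWord one lb rb k).get ⟨k + 2, hi⟩ = rb := by
      rw [numberWord_get, if_neg (by simp), if_neg (by simp)]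
    obtain rfl : j = Fin.castSucc ⟨k + 2, hi⟩ := Fin.ext hj
    have hlast : Fin.last (numberWord one lb rb k).length = Fin.succ ⟨k + 2, hi⟩ :=
      Fin.ext hlen
    rw [hlast]
    refine .single (parallel_step_transmit _ ⟨.closing (Nat.bodd (k + 1)), rfl, rfl, ?_, rfl, rfl⟩)
    rw [hget]
    rfl
  | succ r ih =>
    have hi : m + 1 < (numberWord one lb rb k).length := by omega
    have hget : (numberWord one lb rb k).get ⟨m + 1, hi⟩ = one := by
      rw [numberWord_get, if_neg (by simp), if_pos (by simp; omega)]
    obtain rfl : j = Fin.castSucc ⟨m + 1, hi⟩ := Fin.ext hj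
    refine .head (parallel_step_transmit _ ⟨.digit (Nat.bodd m), rfl, rfl, ?_, rfl, rfl⟩)
      (ih (m + 1) (by omega) (Fin.succ ⟨m + 1, hi⟩) rfl)
    rw [hget]
    rfl

theorem parallel_step_opening :
    (parallel {u} (RTM.sendNumber A u one lb rb k).lts (machine u one lb rb e).lts).step
      (((0 : Fin (_ + 1)), Tape.mk₁ []), (.wait, 0)) none
        (((1 : Fin ((numberWord one lb rb k).length + 1)), Tape.mk₁ []), (.count, 0)) := by
  have hi : 0 < (numberWord one lb rb k).length := by simp
  have h1 : (1 : Fin ((numberWord one lb rb k).length + 1)) = Fin.succ ⟨0, hi⟩ :=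
    Fin.ext (by simp)
  rw [h1]
  refine parallel_step_transmit ⟨0, hi⟩ ⟨.opening false, rfl, Nat.bodd_zero.symm, ?_, rfl, rfl⟩
  rw [numberWord_get, if_pos rfl]
  rfl

variable [Finite A] [Finite C] [Finite D]

/-- The universal machine can always start or resume trying labels. -/
theorem Sim.exists_loop (hk : RepresentsData ν M.lts.init (initData k))
    {c : M.lts.State} {s : (parallel {u} (RTM.sendNumber A u one lb rb k).lts
      (machine u one lb rb e).lts).State}
    (h : Sim u one lb rb e ν k c s) : ∃ (T : Tape (Option D)) (g : Option (Fin N)) (y : SimData),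
      RepresentsData ν c y ∧ (parallel {u} (RTM.sendNumber A u one lb rb k).lts
        (machine u one lb rb e).lts).TauSteps s
          ((Fin.last _, T), (.loop g, pack (labelCode e g) y)) := by
  cases h with
  | wait =>
    exact ⟨_, none, _, hk, .head parallel_step_opening
      (tauSteps_count (k + 1) 0 (by omega) 1 (by simp))⟩
  | count m hm j hj =>
    exact ⟨_, none, _, hk,
      tauSteps_count (k + 1 - m) m (by omega) j hj⟩
  | loop h T g => exact ⟨T, g, _, h, .refl⟩
  | halted h T hy =>
    exact ⟨T, none, _, h, parallel_tauSteps_right _ _ _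
      (.single ⟨.resume _, rfl, rfl, rfl, rfl, rfl⟩)⟩

/-- From any related state the search can be steered to the label and the transition of the given
step without leaving the relation, and then the transition is executed. -/
theorem Sim.step_left (hk : RepresentsData ν M.lts.init (initData k)) (hM : M.DoesNotUse u)
    {c c' : M.lts.State} {s : (parallel {u} (RTM.sendNumber A u one lb rb k).lts
      (machine u one lb rb e).lts).State}
    (h : Sim u one lb rb e ν k c s) {a : CommActionTau A C D} (hs : M.lts.step c a c') :
    ∃ s'' s', (parallel {u} (RTM.sendNumber A u one lb rb k).lts
        (machine u one lb rb e).lts).TauSteps s s'' ∧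
      (parallel {u} (RTM.sendNumber A u one lb rb k).lts
        (machine u one lb rb e).lts).OptStep s'' a s' ∧
      Sim u one lb rb e ν k c s'' ∧ Sim u one lb rb e ν k c' s' := by
  obtain ⟨T, g, y, hy, hτ⟩ := h.exists_loop hk
  obtain ⟨i, hen, hc'⟩ := hy.exists_candidate hs
  have hlabel : labelCode e (some (e a)) = some (Encodable.encode a) := by simp [labelCode]
  -- An action along `u` would be blocked by the parallel composition.
  have hK : ¬ CommunicatesOn {u} a := by
    obtain ⟨d, m, hrel, -⟩ := hs
    exact hM _ _ _ _ _ _ hrel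
  refine ⟨_, ((Fin.last _, T), (.loop none, pack (labelCode e none) (execute _))), hτ.trans
    (parallel_tauSteps_right _ _ _ (machine_tauSteps_loop g (some (e a)) y i)),
    .inl ⟨hK, .inl (.inr ⟨⟨.exec (e a), rfl, ?_, e.symm_apply_apply a, rfl, ?_⟩, rfl⟩)⟩,
    .loop (y := (y.1, y.2.1, y.2.2.1, i)) hy T (some (e a)), .loop hc' T none⟩
  · simp only [bodd_pack, hlabel, hen]
    rfl
  · simp only [machine, unpack_pack]
    rfl

/-- Only `exec` advances `M`, and its guard certifies a genuine transition. Every other step is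
silent and keeps the represented configuration. -/
theorem Sim.step_right (hk : RepresentsData ν M.lts.init (initData k)) (h_one_rb : one ≠ rb)
    {c : M.lts.State} {s s' : (parallel {u} (RTM.sendNumber A u one lb rb k).lts
      (machine u one lb rb e).lts).State}
    (h : Sim u one lb rb e ν k c s) {a : CommActionTau A C D} (hs : (parallel {u}
      (RTM.sendNumber A u one lb rb k).lts
        (machine u one lb rb e).lts).step s a s') :
    ∃ c', M.lts.OptStep c a c' ∧ Sim u one lb rb e ν k c' s' := by
  obtain ⟨⟨j', T'⟩, ⟨q', x'⟩⟩ := s'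
  cases h with
  | wait =>
    obtain ⟨rfl, i, hi, hj', hT', r, hsrc, -, hact, htgt, hx'⟩ := parallel_step_inv hs (by
      rintro b ⟨r, hsrc, -, rfl, -⟩
      cases r <;> cases hsrc
      exact ⟨_, rfl⟩)
    have hi0 : (i : ℕ) = 0 := congrArg Fin.val hi.symm
    obtain rfl : j' = i.succ := hj'
    obtain rfl : T' = Tape.mk₁ [] := hT'.trans Tape.write_move_mk₁_nil
    cases r <;> cases hsrc
    obtain rfl : Control.count = q' := htgt
    obtain rfl : x' = 0 := hx'
    exact ⟨_, .inr ⟨rfl, rfl⟩, .count 0 (by omega) _ (by simp [hi0])⟩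
  | count m hm j hj =>
    obtain ⟨rfl, i, hi, hj', hT', r, hsrc, -, hact, htgt, hx'⟩ := parallel_step_inv hs (by
      rintro b ⟨r, hsrc, -, rfl, -⟩
      cases r <;> cases hsrc <;> exact ⟨_, rfl⟩)
    have him : (i : ℕ) = m + 1 := (congrArg Fin.val hi.symm).trans hj
    obtain rfl : j' = i.succ := hj'
    obtain rfl : T' = Tape.mk₁ [] := hT'.trans Tape.write_move_mk₁_nil
    rw [numberWord_get, if_neg (by omega), him] at hact
    cases r <;> cases hsrc
    · obtain rfl : Control.count = q' := htgt
      obtain rfl : x' = m + 1 := hx'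
      -- Digits and the closing bracket are received in the same control state; `one ≠ rb` prevents
      -- confusing them, so the count ends at exactly `k + 1`.
      have hle : m + 1 ≤ k + 1 := by
        by_contra hle
        rw [if_neg hle] at hact
        simp only [machine, Option.some.injEq, CommAction.recv.injEq, true_and] at hact
        exact h_one_rb hact
      exact ⟨_, .inr ⟨rfl, rfl⟩, .count (m + 1) hle _ (by simp [him])⟩
    · obtain rfl : Control.loop none = q' := htgt
      have hle : ¬ m + 1 ≤ k + 1 := by
        intro hle
        rw [if_pos hle] at hact
        simp only [machine, Option.some.injEq, CommAction.recv.injEq, true_and] at hact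
        exact h_one_rb hact.symm
      obtain rfl : m = k + 1 := by omega
      obtain rfl : x' = pack (labelCode e none) (initData k) := hx'
      have hlast : i.succ = Fin.last _ := Fin.ext (by simp [him])
      rw [hlast]
      exact ⟨_, .inr ⟨rfl, rfl⟩, .loop hk _ none⟩
  | @loop _ y hy _ g =>
    obtain ⟨⟨r, hsrc, hguard, rfl, htgt, hx'⟩, hp⟩ := parallel_step_last hs
    cases hp
    cases r <;> cases hsrc
    · rename_i b g' i
      obtain rfl : Control.loop g' = q' := htgt
      obtain rfl : x' = pack (labelCode e g') (nextCandidate i y) := by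
        refine Eq.trans hx' ?_
        simp only [machine, unpack_pack]
      exact ⟨c, .inr ⟨rfl, rfl⟩, .loop (hy.nextCandidate i) T' g'⟩
    · rename_i j
      obtain rfl : Control.loop none = q' := htgt
      obtain rfl : x' = pack (labelCode e none) (execute y) := by
        refine Eq.trans hx' ?_
        simp only [machine, unpack_pack]
        rfl
      rw [bodd_pack] at hguard
      obtain ⟨c', hc', hr⟩ := hy.exists_step (a := e.symm j) hguard.symm
      exact ⟨c', .inl hc', .loop hr T' none⟩
    · obtain rfl : Control.halted = q' := htgt
      obtain rfl : x' = pack none y := hx'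
      rw [bodd_pack] at hguard
      exact ⟨c, .inr ⟨rfl, rfl⟩, .halted hy T' hguard.symm⟩
  | halted hy _ hen =>
    obtain ⟨⟨r, hsrc, -, rfl, htgt, hx'⟩, hp⟩ := parallel_step_last hs
    cases hp
    cases r <;> cases hsrc
    obtain rfl : Control.loop none = q' := htgt
    subst hx'
    exact ⟨c, .inr ⟨rfl, rfl⟩, .loop hy T' none⟩

/-- The search is steered to the termination label. By then the sender has delivered its whole word
and is in its final state, so the pair is final. -/
theorem Sim.final_left (hk : RepresentsData ν M.lts.init (initData k))
    {c : M.lts.State} {s : (parallel {u} (RTM.sendNumber A u one lb rb k).lts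
      (machine u one lb rb e).lts).State}
    (h : Sim u one lb rb e ν k c s) (hc : c ∈ M.lts.final) :
    ∃ s', (parallel {u} (RTM.sendNumber A u one lb rb k).lts
        (machine u one lb rb e).lts).TauSteps s s' ∧ Sim u one lb rb e ν k c s' ∧
      s' ∈ (parallel {u} (RTM.sendNumber A u one lb rb k).lts
        (machine u one lb rb e).lts).final := by
  obtain ⟨T, g, y, hy, hτ⟩ := h.exists_loop hk
  have hen := (RepresentsData.mem_final_iff (y := (y.1, y.2.1, y.2.2.1, 0)) hy).2 hc
  refine ⟨_, hτ.trans (parallel_tauSteps_right _ _ _ ((machine_tauSteps_loop g none y 0).tail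
    (c := (Control.halted, pack none (y.1, y.2.1, y.2.2.1, 0)))
    ⟨.halt, rfl, ?_, rfl, rfl, rfl⟩)), .halted (y := (y.1, y.2.1, y.2.2.1, 0)) hy T hen, rfl, rfl⟩
  rw [bodd_pack]
  exact hen.symm

theorem Sim.final_right {c : M.lts.State} {s : (parallel {u}
    (RTM.sendNumber A u one lb rb k).lts (machine u one lb rb e).lts).State}
    (h : Sim u one lb rb e ν k c s) (hs : s ∈ (parallel {u}
      (RTM.sendNumber A u one lb rb k).lts (machine u one lb rb e).lts).final) :
    c ∈ M.lts.final := by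
  cases h with
  | wait => cases hs.2
  | count => cases hs.2
  | loop => cases hs.2
  | halted hy T hen => exact hy.mem_final_iff.1 hen

/-- The universal machine on numbers, supplied with a Gödel number of `M`, simulates `M`. -/
theorem branchingBisimilar_machine (e : CommActionTau A C D ≃ Fin N) (lb : D)
    (h_one_rb : one ≠ rb) (hM : M.DoesNotUse u) (ν : M.State ≃ Fin n) :
    BranchingBisimilar M.lts (parallel {u} (RTM.sendNumber A u one lb rb (M.godelNumber ν)).lts
      (machine u one lb rb e).lts) := by
  have hk : RepresentsData ν M.lts.init (initData (M.godelNumber ν)) := representsData_initData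
  refine ⟨Sim u one lb rb e ν (M.godelNumber ν), ⟨fun c s h a c' hs => h.step_left hk hM hs,
    fun c s h a s' hs => ?_, fun c s h hc => h.final_left hk hc,
    fun c s h hs => ⟨c, .refl, h, h.final_right hs⟩⟩, .wait⟩
  obtain ⟨c', hopt, hr⟩ := h.step_right hk h_one_rb hs
  exact ⟨c, c', .refl, hopt, h, hr⟩

end UniversalMachine

theorem mainTheorem6 {A : Type uA} {C : Type uC} {D : Type uD}
    [Finite A] [Finite C] [Finite D] [Encodable A] [Encodable C] [Encodable D]
    (u : C) (one lb rb : D) (h_one_lb : one ≠ lb) (h_one_rb : one ≠ rb) (h_lb_rb : lb ≠ rb) :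
    ∃ U : RTM.{uA, uC, uD, 0} A C D,
      ∀ M : RTM.{uA, uC, uD, v} A C D, M.DoesNotUse u →
        ∀ (n : ℕ) (ν : M.State ≃ Fin n),
          TransitionSystem.BranchingBisimilar M.lts
            (TransitionSystem.parallel {u}
              (RTM.sendNumber A u one lb rb (M.godelNumber ν)).lts U.lts) := by
  -- Finiteness of the label set lets the control be fixed before `M` is given.
  obtain ⟨N, ⟨e⟩⟩ := Finite.exists_equiv_fin (CommActionTau A C D)
  obtain ⟨U, hU⟩ := NumMachine.exists_branchingBisimilar_rtm
    (UniversalMachine.machine u one lb rb e) one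
  exact ⟨U, fun M hM n ν => (UniversalMachine.branchingBisimilar_machine e lb h_one_rb hM ν).trans
    (hU.parallel_right {u} _)⟩
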